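/- Let $\Bbbk$ be an algebraically closed field of characteristic $0$, let $G$ be a finite group with identity $e$, and let $\omega:G^{3}\to\Bbbk^\times$ be a normalized 3-cocycle, i.e. $\omega(a,b,c)=1$ if one of $a,b,c$ is $e$, and $$\omega(ab,c,d)\,\omega(a,b,cd)=\omega(a,b,c)\,\omega(a,bc,d)\,\omega(b,c,d)\qquad(a,b,c,d\in G).$$ Let $\mathsf{Vec}_G^\omega$ be the monoidal category of finite-dimensional $G$-graded $\Bbbk$-vector spaces with degree-preserving linear maps, the tensor product $(V\otimes W)_x=\bigoplus_{yz=x}V_y\otimes W_z$, the unit object $\Bbbk$ in degree $e$, the usual unit constraints, and the associativity constraint $(u\otimes v)\otimes w\mapsto\omega^{-1}(x,y,z)\,u\otimes(v\otimes w)$ for $u,v,w$ homogeneous of degrees $x,y,z$. Write $\delta_g$ for a basis vector of a one-dimensional space in degree $g$. For a subgroup $N\le G$ and a function $\theta:N^2\to\Bbbk^\times$ with $\theta(e,f)=\theta(f,e)=1$ and $$\theta(f_1,f_2f_3)\,\theta(f_2,f_3)=\omega(f_1,f_2,f_3)\,\theta(f_1f_2,f_3)\,\theta(f_1,f_2)\qquad(f_1,f_2,f_3\in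 N),$$ let $A(N,\theta)=\bigoplus_{g\in N}\Bbbk\delta_g$ be the algebra in $\mathsf{Vec}_G^\omega$ with multiplication $\delta_g\otimes\delta_{g'}\mapsto\theta(g,g')\delta_{gg'}$ and unit $\delta_e$. Let $K,L\le G$ be subgroups with such functions $\beta$ on $K$ and $\psi$ on $L$. Let $\mathcal C(G,\omega,K,\beta)$ be the $\Bbbk$-linear monoidal category of $A(K,\beta)$-bimodules in $\mathsf{Vec}_G^\omega$, with tensor product $\otimes_{A(K,\beta)}$ and unit object $A(K,\beta)$. The *twisted Hecke algebra* is the object $$A^{K,\beta}(L,\psi)=(A(K,\beta)\otimes A(L,\psi))\otimes A(K,\beta)$$ of $\mathcal C(G,\omega,K,\beta)$, on whose outer tensor factors $A(K,\beta)$ acts by multiplication. It has the basis $b_{f,g,k}=(\delta_f\otimes\delta_g)\otimes\delta_k$, where $f,k\in K$ and $g\in L$. **Proposition.** There are morphisms $m,u,\Delta,\varepsilon$ in $\mathcal C(G,\omega,K,\beta)$, uniquely determined by $$m(b_{f,g,k}\otimes_{A(K,\beta)}b_{f',g',k'})=\delta_{kf',e}\,\omega(fgk,f'g',k')\,\omega^{-1}(fg,k,f'g')\,\omega(k,f',g')\,\omega^{-1}(f,g,g')\,\beta(k,f')\,\psi(g,g')\,b_{f,gg',k'},$$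 $$u(\delta_d)=\sum_{s\in K}\beta^{-1}(ds^{-1},s)\,b_{ds^{-1},e,s},$$ $$\Delta(b_{f,g,k})=\frac1{|K||L|}\sum_{h\in L,\;s\in K}\omega(f,gh,h^{-1})\,\omega(fgh,s,s^{-1}h^{-1})\,\omega^{-1}(fghs,s^{-1}h^{-1},k)\,\omega^{-1}(s,s^{-1},h^{-1})\,\psi^{-1}(gh,h^{-1})\,\beta^{-1}(s,s^{-1})\;b_{f,gh,s}\otimes_{A(K,\beta)}b_{s^{-1},h^{-1},k},$$ $$\varepsilon(b_{f,g,k})=\delta_{g,e}\,|L|\,\beta(f,k)\,\delta_{fk}$$ for $f,f',k,k',d\in K$ and $g,g'\in L$ (inverses of cochains are multiplicative inverses of their values), and with them $A=A^{K,\beta}(L,\psi)$ is a Frobenius algebra in $\mathcal C(G,\omega,K,\beta)$: $(A,m,u)$ is an algebra, $(A,\Delta,\varepsilon)$ is a coalgebra, and $(m\otimes\mathrm{id})\alpha^{-1}(\mathrm{id}\otimes\Delta)=\Delta m=(\mathrm{id}\otimes m)\alpha(\Delta\otimes\mathrm{id})$, where $\alpha$ and $\otimes$ are the associativity constraint and the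 tensor product of $\mathcal C(G,\omega,K,\beta)$. Moreover: 1. $A$ is indecomposable: it is nonzero and not isomorphic, as an algebra in $\mathcal C(G,\omega,K,\beta)$, to a direct sum of two nonzero algebras. 2. $A$ is separable: there is a morphism $\Delta':A\to A\otimes A$ with $m\Delta'=\mathrm{id}_A$ and $(\mathrm{id}\otimes m)\alpha(\Delta'\otimes\mathrm{id})=\Delta' m=(m\otimes\mathrm{id})\alpha^{-1}(\mathrm{id}\otimes\Delta')$. 3. $A$ is special: $m\Delta=\mathrm{id}_A$, and $\varepsilon u$ is a nonzero multiple of the identity of the unit object. More precisely, $$m\Delta=\mathrm{id}_A,\qquad \varepsilon u=|K|\,|L|\;\mathrm{id}_{A(K,\beta)}.$$ -/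

import Mathlib

open CategoryTheory MonoidalCategory Limits
open scoped MonObj ComonObj TensorProduct

universe w v u

section BimoduleCategory

variable {C : Type u} [Category.{v} C] [MonoidalCategory C]

section Monoidal

variable [HasCoequalizers C] [∀ X : C, PreservesColimitsOfSize.{0, 0} (tensorLeft X)]
  [∀ X : C, PreservesColimitsOfSize.{0, 0} (tensorRight X)]

/-- The category of bimodules over an algebra `A` in `C` is monoidal: the tensor product
`M ⊗_A N` is the coequalizer of the two actions of `A` on `M ⊗ N`, the unit object is `A`, and
the constraints are induced by those of `C`. -/
noncomputable instance bimodMonoidal (A : Mon C) : MonoidalCategory (Bimod A A) where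
  tensorObj M N := M.tensorBimod N
  whiskerLeft M _ _ f := Bimod.whiskerLeft M f
  whiskerRight f N := Bimod.whiskerRight f N
  tensorUnit := Bimod.regular A
  associator := Bimod.associatorBimod
  leftUnitor := Bimod.leftUnitorBimod
  rightUnitor := Bimod.rightUnitorBimod
  tensorHom_def _ _ := rfl
  id_tensorHom_id M N := by
    rw [Bimod.id_whiskerRight_bimod, Bimod.whiskerLeft_id_bimod, Category.id_comp]
  tensorHom_comp_tensorHom {M₁ N₁ P₁ M₂ N₂ P₂} f₁ f₂ g₁ g₂ := by
    rw [Bimod.comp_whiskerRight_bimod, Bimod.whiskerLeft_comp_bimod, Category.assoc,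
      Category.assoc, ← Category.assoc (Bimod.whiskerLeft N₁ f₂), Bimod.whisker_exchange_bimod,
      Category.assoc]
  whiskerLeft_id _ _ := Bimod.whiskerLeft_id_bimod
  id_whiskerRight _ _ := Bimod.id_whiskerRight_bimod
  associator_naturality {M₁ M₂ M₃ N₁ N₂ N₃} f₁ f₂ f₃ := by
    let _ := Bimod.monBicategory (C := C)
    exact MonoidalCategory.associator_naturality (C := EndMonoidal A) f₁ f₂ f₃
  leftUnitor_naturality f := by
    let _ := Bimod.monBicategory (C := C)
    exact MonoidalCategory.leftUnitor_naturality (C := EndMonoidal A) f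
  rightUnitor_naturality f := by
    let _ := Bimod.monBicategory (C := C)
    exact MonoidalCategory.rightUnitor_naturality (C := EndMonoidal A) f
  pentagon M N P Q := Bimod.pentagon_bimod M N P Q
  triangle M N := Bimod.triangle_bimod M N

/-- The canonical projection `M ⊗ N ⟶ M ⊗_A N`. -/
noncomputable def bimodProj {A : Mon C} (M N : Bimod A A) : M.X ⊗ N.X ⟶ (M ⊗ N).X :=
  coequalizer.π (M.actRight ▷ N.X) ((α_ M.X A.X N.X).hom ≫ M.X ◁ N.actLeft)

end Monoidal

section Linear

variable [Preadditive C] [MonoidalPreadditive C] {A B : Mon C}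

namespace Bimod


instance (M N : Bimod A B) : Zero (M ⟶ N) := ⟨{ hom := 0 }⟩

instance (M N : Bimod A B) : Add (M ⟶ N) := ⟨fun f g => { hom := f.hom + g.hom }⟩

instance (M N : Bimod A B) : Neg (M ⟶ N) := ⟨fun f =>
  { hom := -f.hom
    left_act_hom := by
      have h := (tensorLeft A.X).map_neg (f := f.hom)
      dsimp [tensorLeft] at h
      simp [h]
    right_act_hom := by
      have h := (tensorRight B.X).map_neg (f := f.hom)
      dsimp [tensorRight] at h
      simp [h] }⟩

@[simp] lemma zero_hom' (M N : Bimod A B) : (0 : M ⟶ N).hom = 0 := rfl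

@[simp] lemma add_hom' {M N : Bimod A B} (f g : M ⟶ N) : (f + g).hom = f.hom + g.hom := rfl

@[simp] lemma neg_hom' {M N : Bimod A B} (f : M ⟶ N) : (-f).hom = -f.hom := rfl

instance (M N : Bimod A B) : AddCommGroup (M ⟶ N) where
  add_assoc _ _ _ := hom_ext _ _ (add_assoc _ _ _)
  zero_add _ := hom_ext _ _ (zero_add _)
  add_zero _ := hom_ext _ _ (add_zero _)
  neg_add_cancel _ := hom_ext _ _ (neg_add_cancel _)
  add_comm _ _ := hom_ext _ _ (add_comm _ _)
  nsmul := nsmulRec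
  zsmul := zsmulRec

/-- Morphisms of bimodules are added in the ambient category. -/
instance : Preadditive (Bimod A B) where
  homGroup := inferInstance
  add_comp _ _ _ _ _ _ := hom_ext _ _ (Preadditive.add_comp _ _ _ _ _ _)
  comp_add _ _ _ _ _ _ := hom_ext _ _ (Preadditive.comp_add _ _ _ _ _ _)

variable {k : Type w} [Field k] [Linear k C] [MonoidalLinear k C]

instance (M N : Bimod A B) : SMul k (M ⟶ N) := ⟨fun c f => { hom := c • f.hom }⟩

@[simp] lemma smul_hom' {M N : Bimod A B} (c : k) (f : M ⟶ N) : (c • f).hom = c • f.hom := rfl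

instance (M N : Bimod A B) : Module k (M ⟶ N) where
  one_smul _ := hom_ext _ _ (one_smul _ _)
  mul_smul _ _ _ := hom_ext _ _ (mul_smul _ _ _)
  smul_zero _ := hom_ext _ _ (smul_zero _)
  smul_add _ _ _ := hom_ext _ _ (smul_add _ _ _)
  add_smul _ _ _ := hom_ext _ _ (add_smul _ _ _)
  zero_smul _ := hom_ext _ _ (zero_smul _ _)

/-- Morphisms of bimodules are multiplied by scalars in the ambient category. -/
instance : Linear k (Bimod A B) where
  homModule := inferInstance
  smul_comp _ _ _ _ _ _ := hom_ext _ _ (Linear.smul_comp _ _ _ _ _ _)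
  comp_smul _ _ _ _ _ _ := hom_ext _ _ (Linear.comp_smul _ _ _ _ _ _)

end Bimod

end Linear

/-- The free bimodule `(A ⊗ X) ⊗ A` on an object `X`; `A` acts by multiplication on the outer
tensor factors. -/
def freeBimod (A : Mon C) (X : C) : Bimod A A where
  X := (A.X ⊗ X) ⊗ A.X
  actLeft := (α_ A.X (A.X ⊗ X) A.X).inv ≫ (α_ A.X A.X X).inv ▷ A.X ≫ (μ[A.X] ▷ X) ▷ A.X
  actRight := (α_ (A.X ⊗ X) A.X A.X).hom ≫ (A.X ⊗ X) ◁ μ[A.X]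
  one_actLeft := by
    trans ((α_ _ _ _).inv ≫ (α_ _ _ _).inv ▷ A.X) ≫ ((η[A.X] ▷ A.X ≫ μ[A.X]) ▷ X) ▷ A.X
    · monoidal
    · rw [MonObj.one_mul]
      monoidal
  left_assoc := by
    trans ((α_ _ _ _).inv ≫ (α_ _ _ _).inv ▷ A.X) ≫ ((μ[A.X] ▷ A.X ≫ μ[A.X]) ▷ X) ▷ A.X
    · monoidal
    · rw [MonObj.mul_assoc]
      monoidal
  actRight_one := by
    trans (α_ _ _ _).hom ≫ (A.X ⊗ X) ◁ (A.X ◁ η[A.X] ≫ μ[A.X])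
    · monoidal
    · rw [MonObj.mul_one]
      monoidal
  right_assoc := by
    trans (α_ (A.X ⊗ X) A.X (A.X ⊗ A.X)).hom ≫ (A.X ⊗ X) ◁ (A.X ◁ μ[A.X] ≫ μ[A.X])
    · monoidal
    · rw [show A.X ◁ μ[A.X] ≫ μ[A.X] = (α_ _ _ _).inv ≫ μ[A.X] ▷ A.X ≫ μ[A.X] by simp]
      monoidal
  middle_assoc := by
    trans ((α_ _ _ _).inv ▷ _ ≫ (α_ _ _ _).inv ▷ _ ▷ _ ≫ (α_ _ _ _).hom) ≫
        (μ[A.X] ▷ X) ▷ (A.X ⊗ A.X) ≫ (A.X ⊗ X) ◁ μ[A.X]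
    · monoidal
    · rw [← whisker_exchange]
      monoidal

end BimoduleCategory

section AlgebraNotions

variable {C : Type u} [Category.{v} C] [MonoidalCategory C]

/-- An algebra and coalgebra `A` in a monoidal category is a Frobenius algebra if
`(m ⊗ id) α⁻¹ (id ⊗ Δ) = Δ m = (id ⊗ m) α (Δ ⊗ id)`. -/
structure IsFrobeniusAlg (A : C) [MonObj A] [ComonObj A] : Prop where
  left : A ◁ Δ[A] ≫ (α_ A A A).inv ≫ μ[A] ▷ A = μ[A] ≫ Δ[A]
  right : Δ[A] ▷ A ≫ (α_ A A A).hom ≫ A ◁ μ[A] = μ[A] ≫ Δ[A]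

/-- An algebra `A` is separable if its multiplication has a section that is a morphism of
`A`-bimodules. -/
def IsSeparableAlg (A : C) [MonObj A] : Prop :=
  ∃ D : A ⟶ A ⊗ A, D ≫ μ[A] = 𝟙 A ∧
    D ▷ A ≫ (α_ A A A).hom ≫ A ◁ μ[A] = μ[A] ≫ D ∧
    A ◁ D ≫ (α_ A A A).inv ≫ μ[A] ▷ A = μ[A] ≫ D

variable [Preadditive C]

/-- `A ≅ S ⊕ T` as algebras: `A` is a biproduct of `S` and `T` such that both projections are
morphisms of algebras, that is, the multiplication and the unit of `A` are those of `S` and `T`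
taken componentwise. -/
def IsDirectSumAlg (A S T : C) [MonObj A] [MonObj S] [MonObj T] : Prop :=
  ∃ (p : A ⟶ S) (q : A ⟶ T) (i : S ⟶ A) (j : T ⟶ A), IsMonHom p ∧ IsMonHom q ∧
    i ≫ p = 𝟙 S ∧ j ≫ q = 𝟙 T ∧ i ≫ q = 0 ∧ j ≫ p = 0 ∧ p ≫ i + q ≫ j = 𝟙 A

/-- An algebra is indecomposable if it is nonzero and not isomorphic to the direct sum of two
nonzero algebras. -/
def IsIndecomposableAlg (A : C) [MonObj A] : Prop :=
  ¬ IsZero A ∧ ∀ (S T : C) [MonObj S] [MonObj T], IsDirectSumAlg A S T → IsZero S ∨ IsZero T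

/-- A Frobenius algebra over `k` is special if `m Δ = id` and `ε u` is a nonzero multiple of the
identity. -/
def IsSpecialAlg (k : Type w) [Field k] [Linear k C] (A : C) [MonObj A] [ComonObj A] : Prop :=
  Δ[A] ≫ μ[A] = 𝟙 A ∧ ∃ c : k, c ≠ 0 ∧ η[A] ≫ ε[A] = c • 𝟙 (𝟙_ C)

end AlgebraNotions

section GradedSpaces

/-- A normalized `kˣ`-valued 3-cocycle on `G`. -/
structure ThreeCocycle (k G : Type u) [Field k] [Group G] where
  toFun : G → G → G → kˣ
  cocycle : ∀ a b c d : G, toFun (a * b) c d * toFun a b (c * d) =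
    toFun a b c * toFun a (b * c) d * toFun b c d
  one_left : ∀ a b : G, toFun 1 a b = 1
  one_middle : ∀ a b : G, toFun a 1 b = 1
  one_right : ∀ a b : G, toFun a b 1 = 1

instance (k G : Type u) [Field k] [Group G] :
    CoeFun (ThreeCocycle k G) (fun _ => G → G → G → kˣ) := ⟨ThreeCocycle.toFun⟩

open scoped Classical

variable {k G : Type u} [Field k] [Group G] [Fintype G]

/-- An object of `Vec_G^ω`: a finite-dimensional `G`-graded vector space `V = ⨁ x, V_x`. The grading
is recorded by the projections `V → V_x ⊆ V`, a complete family of orthogonal idempotents. The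
cocycle `ω` only enters the associativity constraint. -/
structure GVec (ω : ThreeCocycle k G) : Type (u + 1) where
  carrier : Type u
  [addCommGroup : AddCommGroup carrier]
  [module : Module k carrier]
  [finite : Module.Finite k carrier]
  proj : G → Module.End k carrier
  complete : CompleteOrthogonalIdempotents proj

namespace GVec

variable {ω : ThreeCocycle k G}

attribute [instance] GVec.addCommGroup GVec.module GVec.finite

/-- The homogeneous component of degree `x`. -/
def component (V : GVec ω) (x : G) : Submodule k V.carrier := LinearMap.range (V.proj x)

lemma proj_proj (V : GVec ω) (x y : G) (v : V.carrier) :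
    V.proj x (V.proj y v) = if x = y then V.proj y v else 0 := by
  have h := congrArg (fun f => f v) (V.complete.toOrthogonalIdempotents.mul_eq x y)
  simp only [Module.End.mul_apply] at h
  rw [h]
  split_ifs with hxy
  · rw [hxy]
  · rfl

lemma sum_proj (V : GVec ω) (v : V.carrier) : ∑ x, V.proj x v = v := by
  have h := congrArg (fun f => f v) V.complete.complete
  simpa using h

lemma mem_component_iff (V : GVec ω) {x : G} {v : V.carrier} :
    v ∈ V.component x ↔ V.proj x v = v := by
  constructor
  · rintro ⟨w, rfl⟩
    simp [proj_proj]
  · intro h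
    exact ⟨v, h⟩

/-- The homogeneous components form a grading: `V` is their direct sum. -/
lemma isInternal_component (V : GVec ω) : DirectSum.IsInternal V.component := by
  refine DirectSum.isInternal_submodule_of_iSupIndep_of_iSup_eq_top ?_ ?_
  · refine (iSupIndep_iff_dfinsupp_lsum_injective _).2 fun a b h => ?_
    ext x
    have key : ∀ a : Π₀ x, V.component x,
        V.proj x (DFinsupp.lsum ℕ (fun i => (V.component i).subtype) a) = a x := by
      intro a
      induction a using DFinsupp.induction with
      | h0 => simp
      | ha i b f _ _ ih =>
        rw [map_add, map_add, ih]
        obtain ⟨b, c, rfl⟩ := b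
        by_cases hi : x = i
        · subst hi
          simp [proj_proj]
        · simp [proj_proj, hi, DFinsupp.single_apply, Ne.symm hi]
    rw [← key a, ← key b, h]
  · rw [eq_top_iff]
    intro v _
    rw [← V.sum_proj v]
    exact Submodule.sum_mem _ fun x _ => Submodule.mem_iSup_of_mem x ⟨v, rfl⟩

set_option linter.unusedSectionVars false in
lemma mk_complete {V : Type u} [AddCommGroup V] [Module k V] {p : G → Module.End k V}
    (h : ∀ x y v, p x (p y v) = if x = y then p y v else 0) (hs : ∀ v, ∑ x, p x v = v) :
    CompleteOrthogonalIdempotents p where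
  idem x := by
    ext v
    simp [h]
  ortho x y hxy := by
    ext v
    simp [h, hxy]
  complete := by
    ext v
    simp [hs]

/-- A morphism of `G`-graded vector spaces: a linear map preserving the degree. -/
@[ext]
structure Hom (V W : GVec ω) where
  hom : V.carrier →ₗ[k] W.carrier
  comm : ∀ x v, hom (V.proj x v) = W.proj x (hom v)

instance : Category (GVec ω) where
  Hom V W := Hom V W
  id V := ⟨LinearMap.id, fun _ _ => rfl⟩
  comp f g := ⟨g.hom ∘ₗ f.hom, fun x v => by simp [f.comm, g.comm]⟩

lemma hom_mem_component {V W : GVec ω} (f : V ⟶ W) {x : G} {v : V.carrier}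
    (hv : v ∈ V.component x) : f.hom v ∈ W.component x := by
  rw [mem_component_iff] at hv ⊢
  rw [← f.comm, hv]

@[ext] lemma hom_ext {V W : GVec ω} {f g : V ⟶ W} (h : f.hom = g.hom) : f = g := Hom.ext h

lemma hom_ext' {V W : GVec ω} {f g : V ⟶ W} (h : ∀ v, f.hom v = g.hom v) : f = g :=
  Hom.ext (LinearMap.ext h)

@[simp] lemma id_hom (V : GVec ω) : Hom.hom (𝟙 V) = LinearMap.id := rfl

@[simp] lemma comp_hom {U V W : GVec ω} (f : U ⟶ V) (g : V ⟶ W) :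
    (f ≫ g).hom = g.hom ∘ₗ f.hom := rfl

/-- An isomorphism from a degree-preserving linear equivalence. -/
def mkIso {V W : GVec ω} (e : V.carrier ≃ₗ[k] W.carrier)
    (h : ∀ x v, e (V.proj x v) = W.proj x (e v)) : V ≅ W where
  hom := ⟨e.toLinearMap, h⟩
  inv := ⟨e.symm.toLinearMap, fun x w => by
    apply e.injective
    simp [h]⟩
  hom_inv_id := hom_ext' fun v => e.symm_apply_apply v
  inv_hom_id := hom_ext' fun v => e.apply_symm_apply v

/-! Linear structure -/

instance (V W : GVec ω) : Zero (V ⟶ W) := ⟨⟨0, fun _ _ => by simp⟩⟩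

instance (V W : GVec ω) : Add (V ⟶ W) :=
  ⟨fun f g => ⟨f.hom + g.hom, fun _ _ => by simp [f.comm, g.comm]⟩⟩

instance (V W : GVec ω) : Neg (V ⟶ W) := ⟨fun f => ⟨-f.hom, fun _ _ => by simp [f.comm]⟩⟩

instance (V W : GVec ω) : SMul k (V ⟶ W) := ⟨fun c f => ⟨c • f.hom, fun _ _ => by simp [f.comm]⟩⟩

@[simp] lemma zero_hom (V W : GVec ω) : (0 : V ⟶ W).hom = 0 := rfl

@[simp] lemma add_hom {V W : GVec ω} (f g : V ⟶ W) : (f + g).hom = f.hom + g.hom := rfl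

@[simp] lemma neg_hom {V W : GVec ω} (f : V ⟶ W) : (-f).hom = -f.hom := rfl

@[simp] lemma smul_hom {V W : GVec ω} (c : k) (f : V ⟶ W) : (c • f).hom = c • f.hom := rfl

instance (V W : GVec ω) : AddCommGroup (V ⟶ W) where
  add_assoc _ _ _ := hom_ext (add_assoc _ _ _)
  zero_add _ := hom_ext (zero_add _)
  add_zero _ := hom_ext (add_zero _)
  neg_add_cancel _ := hom_ext (neg_add_cancel _)
  add_comm _ _ := hom_ext (add_comm _ _)
  nsmul := nsmulRec
  zsmul := zsmulRec

instance : Preadditive (GVec ω) where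
  homGroup := inferInstance
  add_comp _ _ _ f f' g := hom_ext (LinearMap.comp_add f.hom f'.hom g.hom)
  comp_add _ _ _ f g g' := hom_ext (LinearMap.add_comp f.hom g'.hom g.hom)

instance (V W : GVec ω) : Module k (V ⟶ W) where
  one_smul _ := hom_ext (one_smul _ _)
  mul_smul _ _ _ := hom_ext (mul_smul _ _ _)
  smul_zero _ := hom_ext (smul_zero _)
  smul_add _ _ _ := hom_ext (smul_add _ _ _)
  add_smul _ _ _ := hom_ext (add_smul _ _ _)
  zero_smul _ := hom_ext (zero_smul _ _)

instance : Linear k (GVec ω) where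
  homModule := inferInstance
  smul_comp _ _ _ c f g := hom_ext (LinearMap.comp_smul g.hom c f.hom)
  comp_smul _ _ _ f c g := hom_ext (LinearMap.smul_comp c g.hom f.hom)

/-! Tensor products -/

/-- The tensor product: `(V ⊗ W)_x` is the sum of the `V_y ⊗ W_z` with `y z = x`. -/
noncomputable def tensor (V W : GVec ω) : GVec ω where
  carrier := V.carrier ⊗[k] W.carrier
  proj x := ∑ y, TensorProduct.map (V.proj y) (W.proj (y⁻¹ * x))
  complete := by
    apply mk_complete
    · intro x y t
      induction t with
      | zero => simp
      | add s t hs ht =>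
        rw [map_add, map_add, hs, ht]
        split_ifs <;> simp
      | tmul v w =>
        simp only [LinearMap.sum_apply, TensorProduct.map_tmul, map_sum, proj_proj]
        rw [Finset.sum_comm]
        split_ifs with h
        · subst h
          refine Finset.sum_congr rfl fun a _ => ?_
          rw [Finset.sum_eq_single a]
          · simp
          · intro b _ hb
            simp [Ne.symm hb]
          · simp
        · refine Finset.sum_eq_zero fun a _ => Finset.sum_eq_zero fun b _ => ?_
          by_cases hb : a = b
          · subst hb
            simp [h]
          · simp [hb]
    · intro t
      induction t with
      | zero => simp
      | add s t hs ht => simp only [map_add, Finset.sum_add_distrib, hs, ht]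
      | tmul v w =>
        simp only [LinearMap.sum_apply, TensorProduct.map_tmul]
        rw [Finset.sum_comm]
        simp only [← TensorProduct.tmul_sum]
        have h : ∀ y : G, ∑ x, W.proj (y⁻¹ * x) w = w := fun y => by
          rw [← Equiv.sum_comp (Equiv.mulLeft y)]
          simp [sum_proj]
        simp only [h, ← TensorProduct.sum_tmul, sum_proj]

/-- The element `v ⊗ w` of `V ⊗ W`, as a bilinear map. -/
noncomputable def tmul {V W : GVec ω} :
    V.carrier →ₗ[k] W.carrier →ₗ[k] (tensor V W).carrier :=
  TensorProduct.mk k V.carrier W.carrier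

lemma tensor_ext {V W : GVec ω} {Z : Type*} [AddCommGroup Z] [Module k Z]
    {f g : (tensor V W).carrier →ₗ[k] Z} (h : ∀ v w, f (tmul v w) = g (tmul v w)) : f = g :=
  TensorProduct.ext' h

lemma ext_component {V : GVec ω} {Z : Type*} [AddCommGroup Z] [Module k Z]
    {f g : V.carrier →ₗ[k] Z} (h : ∀ x, ∀ v ∈ V.component x, f v = g v) : f = g := by
  ext v
  rw [← V.sum_proj v, map_sum, map_sum]
  exact Finset.sum_congr rfl fun x _ => h x _ ⟨v, rfl⟩

/-- Linear maps on a tensor product that agree on all `v ⊗ w` with `v` homogeneous agree. -/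
lemma tensor_ext_left {V W : GVec ω} {Z : Type*} [AddCommGroup Z] [Module k Z]
    {f g : (tensor V W).carrier →ₗ[k] Z}
    (h : ∀ w, f ∘ₗ tmul.flip w = g ∘ₗ tmul.flip w) : f = g :=
  tensor_ext fun v w => congrArg (fun f => f v) (h w)

lemma tensor_ext_right {V W : GVec ω} {Z : Type*} [AddCommGroup Z] [Module k Z]
    {f g : (tensor V W).carrier →ₗ[k] Z}
    (h : ∀ v, f ∘ₗ tmul v = g ∘ₗ tmul v) : f = g :=
  tensor_ext fun v w => congrArg (fun f => f w) (h v)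

/-- Linear maps on a tensor product that agree on all `v ⊗ w` with `v`, `w` homogeneous agree. -/
lemma tensor_ext₂ {V W : GVec ω} {Z : Type*} [AddCommGroup Z] [Module k Z]
    {f g : (tensor V W).carrier →ₗ[k] Z}
    (h : ∀ x, ∀ v ∈ V.component x, ∀ y, ∀ w ∈ W.component y, f (tmul v w) = g (tmul v w)) :
    f = g := by
  refine tensor_ext_left fun w => ext_component fun x v hv => ?_
  change f (tmul v w) = g (tmul v w)
  have : f ∘ₗ tmul v = g ∘ₗ tmul v := ext_component fun y w hw => h x v hv y w hw
  exact congrArg (fun f => f w) this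

lemma tensor_ext₃ {U V W : GVec ω} {Z : Type*} [AddCommGroup Z] [Module k Z]
    {f g : (tensor (tensor U V) W).carrier →ₗ[k] Z}
    (h : ∀ x, ∀ u ∈ U.component x, ∀ y, ∀ v ∈ V.component y, ∀ z, ∀ w ∈ W.component z,
      f (tmul (tmul u v) w) = g (tmul (tmul u v) w)) : f = g := by
  refine tensor_ext_left fun w => tensor_ext₂ fun x u hu y v hv => ?_
  have : f ∘ₗ tmul (tmul u v) = g ∘ₗ tmul (tmul u v) :=
    ext_component fun z w hw => h x u hu y v hv z w hw
  exact congrArg (fun f => f w) this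

lemma tensor_ext₃' {U V W : GVec ω} {Z : Type*} [AddCommGroup Z] [Module k Z]
    {f g : (tensor U (tensor V W)).carrier →ₗ[k] Z}
    (h : ∀ x, ∀ u ∈ U.component x, ∀ y, ∀ v ∈ V.component y, ∀ z, ∀ w ∈ W.component z,
      f (tmul u (tmul v w)) = g (tmul u (tmul v w))) : f = g := by
  refine tensor_ext_right fun u => tensor_ext₂ fun y v hv z w hw => ?_
  have : f ∘ₗ tmul.flip (tmul v w) = g ∘ₗ tmul.flip (tmul v w) :=
    ext_component fun x u hu => h x u hu y v hv z w hw
  exact congrArg (fun f => f u) this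

lemma tensor_ext₄ {U V W X : GVec ω} {Z : Type*} [AddCommGroup Z] [Module k Z]
    {f g : (tensor (tensor (tensor U V) W) X).carrier →ₗ[k] Z}
    (h : ∀ x, ∀ u ∈ U.component x, ∀ y, ∀ v ∈ V.component y, ∀ z, ∀ w ∈ W.component z,
      ∀ t, ∀ s ∈ X.component t,
      f (tmul (tmul (tmul u v) w) s) = g (tmul (tmul (tmul u v) w) s)) : f = g := by
  refine tensor_ext_left fun s => tensor_ext₃ fun x u hu y v hv z w hw => ?_
  have : f ∘ₗ tmul (tmul (tmul u v) w) = g ∘ₗ tmul (tmul (tmul u v) w) :=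
    ext_component fun t s hs => h x u hu y v hv z w hw t s hs
  exact congrArg (fun f => f s) this

lemma tensor_proj_tmul {V W : GVec ω} (x : G) (v : V.carrier) (w : W.carrier) :
    (tensor V W).proj x (tmul v w) = ∑ y, tmul (V.proj y v) (W.proj (y⁻¹ * x) w) := by
  change (∑ y, TensorProduct.map (V.proj y) (W.proj (y⁻¹ * x))) (v ⊗ₜ[k] w) = _
  simp only [LinearMap.sum_apply, TensorProduct.map_tmul]
  rfl

lemma proj_of_mem (V : GVec ω) {x y : G} {v : V.carrier} (hv : v ∈ V.component y) :
    V.proj x v = if x = y then v else 0 := by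
  rw [mem_component_iff] at hv
  rw [← hv, proj_proj]

lemma tmul_mem {V W : GVec ω} {x y : G} {v : V.carrier} {w : W.carrier}
    (hv : v ∈ V.component x) (hw : w ∈ W.component y) :
    tmul v w ∈ (tensor V W).component (x * y) := by
  rw [mem_component_iff, tensor_proj_tmul, Finset.sum_eq_single x]
  · simp [proj_of_mem V hv, proj_of_mem W hw]
  · intro b _ hb
    simp [proj_of_mem V hv, hb]
  · simp

lemma tensor_proj_tmul_left {U V : GVec ω} {a : G} {u : U.carrier} (hu : u ∈ U.component a)
    (x : G) (v : V.carrier) : (tensor U V).proj x (tmul u v) = tmul u (V.proj (a⁻¹ * x) v) := by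
  rw [tensor_proj_tmul, Finset.sum_eq_single a _ (by simp)]
  · simp [proj_of_mem U hu]
  · intro b _ hb
    simp [proj_of_mem U hu, hb]

lemma tensor_proj_tmul_right {U V : GVec ω} {a : G} {u : U.carrier} (hu : u ∈ U.component a)
    (x : G) (v : V.carrier) : (tensor V U).proj x (tmul v u) = tmul (V.proj (x * a⁻¹) v) u := by
  rw [tensor_proj_tmul, Finset.sum_eq_single (x * a⁻¹) _ (by simp)]
  · simp [proj_of_mem U hu]
  · intro b _ hb
    have : b⁻¹ * x ≠ a := fun h => hb (by rw [← h]; group)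
    simp [proj_of_mem U hu, this]

/-- A linear map preserving homogeneous components commutes with the projections. -/
lemma comm_of_mem {V W : GVec ω} (f : V.carrier →ₗ[k] W.carrier)
    (h : ∀ x, ∀ v ∈ V.component x, f v ∈ W.component x) (x : G) (v : V.carrier) :
    f (V.proj x v) = W.proj x (f v) := by
  have : f ∘ₗ V.proj x = W.proj x ∘ₗ f := ext_component fun y v hv => by
    change f (V.proj x v) = W.proj x (f v)
    rw [proj_of_mem V hv, proj_of_mem W (h y v hv)]
    split_ifs <;> simp
  exact congrArg (fun f => f v) this

/-- The operator multiplying `u ⊗ (v ⊗ w)` by `c x y z` for `u`, `v`, `w` homogeneous of degrees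
`x`, `y`, `z`. -/
noncomputable def scale (c : G → G → G → k) (U V W : GVec ω) :
    Module.End k (tensor U (tensor V W)).carrier :=
  ∑ x, ∑ y, ∑ z, c x y z • TensorProduct.map (U.proj x) (TensorProduct.map (V.proj y) (W.proj z))

lemma scale_tmul (c : G → G → G → k) (U V W : GVec ω) {x y z : G} {u : U.carrier}
    {v : V.carrier} {w : W.carrier} (hu : u ∈ U.component x) (hv : v ∈ V.component y)
    (hw : w ∈ W.component z) :
    scale c U V W (tmul u (tmul v w)) = c x y z • tmul u (tmul v w) := by
  change (∑ x, ∑ y, ∑ z, c x y z •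
    TensorProduct.map (U.proj x) (TensorProduct.map (V.proj y) (W.proj z))) (u ⊗ₜ[k] (v ⊗ₜ[k] w)) =
      c x y z • (u ⊗ₜ[k] (v ⊗ₜ[k] w))
  simp only [LinearMap.sum_apply, LinearMap.smul_apply, TensorProduct.map_tmul,
    proj_of_mem U hu, proj_of_mem V hv, proj_of_mem W hw]
  rw [Finset.sum_eq_single x _ (by simp), Finset.sum_eq_single y _ (by simp),
    Finset.sum_eq_single z _ (by simp)]
  · simp only [if_true]
  all_goals
    intro a _ ha
    simp [ha]

lemma scale_scale (c d : G → G → G → k) (h : ∀ x y z, c x y z * d x y z = 1) (U V W : GVec ω)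
    (t : (tensor U (tensor V W)).carrier) :
    scale c U V W (scale d U V W t) = t := by
  have : scale c U V W ∘ₗ scale d U V W = LinearMap.id := by
    refine tensor_ext₃' fun x u hu y v hv z w hw => ?_
    simp only [LinearMap.comp_apply, scale_tmul _ _ _ _ hu hv hw, map_smul, smul_smul,
      mul_comm (d x y z), h, one_smul, LinearMap.id_apply]
  exact congrArg (fun f => f t) this

/-- The linear equivalence underlying the associativity constraint: on homogeneous elements of
degrees `x`, `y`, `z` it is `(u ⊗ v) ⊗ w ↦ ω(x, y, z)⁻¹ • u ⊗ (v ⊗ w)`. -/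
noncomputable def assocEquiv (U V W : GVec ω) :
    (tensor (tensor U V) W).carrier ≃ₗ[k] (tensor U (tensor V W)).carrier :=
  LinearEquiv.trans (M₂ := (tensor U (tensor V W)).carrier)
    (TensorProduct.assoc k U.carrier V.carrier W.carrier)
    { scale (fun x y z => (((ω x y z)⁻¹ : kˣ) : k)) U V W with
      invFun := scale (fun x y z => (ω x y z : k)) U V W
      left_inv := scale_scale _ _ (by simp) U V W
      right_inv := scale_scale _ _ (by simp) U V W }

lemma assocEquiv_tmul (U V W : GVec ω) {x y z : G} {u : U.carrier}
    {v : V.carrier} {w : W.carrier} (hu : u ∈ U.component x) (hv : v ∈ V.component y)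
    (hw : w ∈ W.component z) :
    assocEquiv U V W (tmul (tmul u v) w) =
      (((ω x y z)⁻¹ : kˣ) : k) • tmul u (tmul v w) :=
  scale_tmul _ _ _ _ hu hv hw

lemma assocEquiv_comm (U V W : GVec ω) (a : G) (t : (tensor (tensor U V) W).carrier) :
    assocEquiv U V W ((tensor (tensor U V) W).proj a t) =
      (tensor U (tensor V W)).proj a (assocEquiv U V W t) := by
  have : (assocEquiv U V W).toLinearMap ∘ₗ (tensor (tensor U V) W).proj a =
      (tensor U (tensor V W)).proj a ∘ₗ (assocEquiv U V W).toLinearMap := by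
    refine tensor_ext₃ fun x u hu y v hv z w hw => ?_
    simp only [LinearMap.comp_apply, LinearEquiv.coe_coe, assocEquiv_tmul _ _ _ hu hv hw,
      map_smul, proj_of_mem _ (tmul_mem (tmul_mem hu hv) hw),
      proj_of_mem _ (tmul_mem hu (tmul_mem hv hw)), mul_assoc]
    split_ifs
    · exact assocEquiv_tmul _ _ _ hu hv hw
    · rw [map_zero, smul_zero]
  exact congrArg (fun f => f t) this

/-- The tensor product of morphisms. -/
noncomputable def tensorMap {V₁ W₁ V₂ W₂ : GVec ω} (f : V₁ ⟶ W₁) (g : V₂ ⟶ W₂) :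
    tensor V₁ V₂ ⟶ tensor W₁ W₂ :=
  let h : (tensor V₁ V₂).carrier →ₗ[k] (tensor W₁ W₂).carrier := TensorProduct.map f.hom g.hom
  { hom := h
    comm := fun x t => by
      have : h ∘ₗ (tensor V₁ V₂).proj x = (tensor W₁ W₂).proj x ∘ₗ h := tensor_ext fun v w => by
        have hh : ∀ v w, h (tmul v w) = tmul (f.hom v) (g.hom w) := fun _ _ => rfl
        simp only [LinearMap.comp_apply, tensor_proj_tmul, map_sum, hh, f.comm, g.comm]
      exact congrArg (fun f => f t) this }

/-- The unit object: `k` in degree `1`. -/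
noncomputable def unit (ω : ThreeCocycle k G) : GVec ω where
  carrier := k
  proj x := if x = 1 then LinearMap.id else 0
  complete := mk_complete
    (fun x y v => by by_cases hx : x = 1 <;> by_cases hy : y = 1 <;> simp_all [eq_comm])
    (fun v => by
      rw [Finset.sum_eq_single 1] <;> simp +contextual)

lemma mem_unit (c : (unit ω).carrier) : c ∈ (unit ω).component 1 := by
  rw [mem_component_iff]
  change (if (1 : G) = 1 then (LinearMap.id : k →ₗ[k] k) else 0) c = c
  rw [if_pos rfl]
  rfl

/-- The left unit constraint `c ⊗ v ↦ c v`. -/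
noncomputable def lidEquiv (V : GVec ω) : (tensor (unit ω) V).carrier ≃ₗ[k] V.carrier :=
  TensorProduct.lid k V.carrier

/-- The right unit constraint `v ⊗ c ↦ c v`. -/
noncomputable def ridEquiv (V : GVec ω) : (tensor V (unit ω)).carrier ≃ₗ[k] V.carrier :=
  TensorProduct.rid k V.carrier

lemma lidEquiv_tmul (V : GVec ω) (c : k) (v : V.carrier) :
    lidEquiv V (tmul (V := unit ω) c v) = c • v := rfl

lemma ridEquiv_tmul (V : GVec ω) (c : k) (v : V.carrier) :
    ridEquiv V (tmul (W := unit ω) v c) = c • v := rfl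

lemma lid_comm (V : GVec ω) (x : G) (t : (tensor (unit ω) V).carrier) :
    lidEquiv V ((tensor (unit ω) V).proj x t) = V.proj x (lidEquiv V t) := by
  have : (lidEquiv V).toLinearMap ∘ₗ (tensor (unit ω) V).proj x =
      V.proj x ∘ₗ (lidEquiv V).toLinearMap := tensor_ext₂ fun a c _ y v hv => by
    have h := proj_of_mem (x := x) _ (tmul_mem (mem_unit (ω := ω) c) hv)
    simp only [LinearMap.comp_apply, LinearEquiv.coe_coe]
    erw [h, lidEquiv_tmul, map_smul, proj_of_mem _ hv, one_mul]
    split_ifs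
    · rfl
    · rw [map_zero]
      exact (smul_zero (M := k) (A := V.carrier) c).symm
  exact congrArg (fun f => f t) this

lemma rid_comm (V : GVec ω) (x : G) (t : (tensor V (unit ω)).carrier) :
    ridEquiv V ((tensor V (unit ω)).proj x t) = V.proj x (ridEquiv V t) := by
  have : (ridEquiv V).toLinearMap ∘ₗ (tensor V (unit ω)).proj x =
      V.proj x ∘ₗ (ridEquiv V).toLinearMap := tensor_ext₂ fun y v hv a c _ => by
    have h := proj_of_mem (x := x) _ (tmul_mem hv (mem_unit (ω := ω) c))
    simp only [LinearMap.comp_apply, LinearEquiv.coe_coe]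
    erw [h, ridEquiv_tmul, map_smul, proj_of_mem _ hv, mul_one]
    split_ifs
    · rfl
    · rw [map_zero]
      exact (smul_zero (M := k) (A := V.carrier) c).symm
  exact congrArg (fun f => f t) this

/-- The tensor product of graded spaces, with associativity constraint `ω⁻¹`. As `ω` is normalized,
the unit constraints are the usual ones. -/
noncomputable instance tensorStruct : MonoidalCategoryStruct (GVec ω) where
  tensorObj := tensor
  tensorHom f g := tensorMap f g
  whiskerLeft U _ _ f := tensorMap (𝟙 U) f
  whiskerRight f U := tensorMap f (𝟙 U)
  tensorUnit := unit ω
  associator U V W := mkIso (assocEquiv U V W) (assocEquiv_comm U V W)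
  leftUnitor V := mkIso (lidEquiv V) (lid_comm V)
  rightUnitor V := mkIso (ridEquiv V) (rid_comm V)

@[simp] lemma tensorHom_tmul {V₁ W₁ V₂ W₂ : GVec ω} (f : V₁ ⟶ W₁) (g : V₂ ⟶ W₂)
    (v : V₁.carrier) (w : V₂.carrier) :
    (f ⊗ₘ g).hom (tmul v w) = tmul (f.hom v) (g.hom w) := rfl

@[simp] lemma whiskerLeft_tmul (U : GVec ω) {V W : GVec ω} (f : V ⟶ W)
    (u : U.carrier) (v : V.carrier) : (U ◁ f).hom (tmul u v) = tmul u (f.hom v) := rfl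

@[simp] lemma whiskerRight_tmul {V W : GVec ω} (f : V ⟶ W) (U : GVec ω)
    (v : V.carrier) (u : U.carrier) : (f ▷ U).hom (tmul v u) = tmul (f.hom v) u := rfl

@[simp] lemma leftUnitor_tmul (V : GVec ω) (c : k) (v : V.carrier) :
    (λ_ V).hom.hom (tmul (V := unit ω) c v) = c • v := rfl

@[simp] lemma rightUnitor_tmul (V : GVec ω) (c : k) (v : V.carrier) :
    (ρ_ V).hom.hom (tmul (W := unit ω) v c) = c • v := rfl

lemma associator_tmul {U V W : GVec ω} {x y z : G} {u : U.carrier}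
    {v : V.carrier} {w : W.carrier} (hu : u ∈ U.component x) (hv : v ∈ V.component y)
    (hw : w ∈ W.component z) :
    (α_ U V W).hom.hom (tmul (tmul u v) w) =
      (((ω x y z)⁻¹ : kˣ) : k) • tmul u (tmul v w) :=
  assocEquiv_tmul U V W hu hv hw

noncomputable instance : MonoidalCategory (GVec ω) :=
  MonoidalCategory.ofTensorHom
    (id_tensorHom_id := fun V W => hom_ext (TensorProduct.map_id))
    (id_tensorHom := fun _ {_ _} _ => rfl)
    (tensorHom_id := fun {_ _} _ _ => rfl)
    (tensorHom_comp_tensorHom := fun {_ _ _ _ _ _} f₁ f₂ g₁ g₂ =>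
      hom_ext (TensorProduct.map_comp g₁.hom g₂.hom f₁.hom f₂.hom).symm)
    (associator_naturality := fun {X₁ X₂ X₃ Y₁ Y₂ Y₃} f₁ f₂ f₃ => hom_ext <| tensor_ext₃
      fun x u hu y v hv z w hw => by
      change (α_ Y₁ Y₂ Y₃).hom.hom (tmul (tmul (f₁.hom u) (f₂.hom v)) (f₃.hom w)) =
        (f₁ ⊗ₘ f₂ ⊗ₘ f₃).hom ((α_ X₁ X₂ X₃).hom.hom (tmul (tmul u v) w))
      rw [associator_tmul hu hv hw, map_smul, tensorHom_tmul,
        associator_tmul (hom_mem_component f₁ hu) (hom_mem_component f₂ hv)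
          (hom_mem_component f₃ hw)]
      rfl)
    (leftUnitor_naturality := fun {_ _} f => hom_ext <| TensorProduct.ext' fun c v =>
      (f.hom.map_smul c v).symm)
    (rightUnitor_naturality := fun {_ _} f => hom_ext <| TensorProduct.ext' fun v c =>
      (f.hom.map_smul c v).symm)
    (pentagon := fun U V W X => hom_ext <| tensor_ext₄ fun x u hu y v hv z w hw t s hs => by
      change (U ◁ (α_ V W X).hom).hom ((α_ U (V ⊗ W) X).hom.hom (((α_ U V W).hom ▷ X).hom
          (tmul (tmul (tmul u v) w) s))) =
        (α_ U V (W ⊗ X)).hom.hom ((α_ (U ⊗ V) W X).hom.hom (tmul (tmul (tmul u v) w) s))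
      have hUV : tmul u v ∈ (U ⊗ V).component (x * y) := tmul_mem hu hv
      have hVW : tmul v w ∈ (V ⊗ W).component (y * z) := tmul_mem hv hw
      have hWX : tmul w s ∈ (W ⊗ X).component (z * t) := tmul_mem hw hs
      rw [whiskerRight_tmul, associator_tmul hu hv hw, map_smul, LinearMap.smul_apply, map_smul,
        map_smul]
      erw [associator_tmul hUV hw hs, associator_tmul hu hVW hs]
      rw [map_smul, map_smul, whiskerLeft_tmul, associator_tmul hv hw hs, map_smul]
      erw [associator_tmul hu hv hWX]
      rw [smul_smul, smul_smul, smul_smul, ← Units.val_mul, ← Units.val_mul, ← Units.val_mul]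
      congr 2
      rw [← mul_inv, ← mul_inv, ← mul_inv, ← ω.cocycle, mul_comm])
    (triangle := fun V W => hom_ext <| tensor_ext₃ (V := unit ω) fun x v hv y c hc z w hw => by
      change (V ◁ (λ_ W).hom).hom ((α_ V (unit ω) W).hom.hom (tmul (tmul v c) w)) =
        ((ρ_ V).hom ▷ W).hom (tmul (tmul v c) w)
      have h := associator_tmul hv (mem_unit (ω := ω) c) hw
      rw [h, ω.one_middle, inv_one, Units.val_one, one_smul, whiskerRight_tmul]
      exact (TensorProduct.smul_tmul (R := k) (show k from c) v w).symm)

instance : MonoidalPreadditive (GVec ω) where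
  whiskerLeft_zero := hom_ext <| tensor_ext fun v w => by
    rw [whiskerLeft_tmul]; simp
  zero_whiskerRight := hom_ext <| tensor_ext fun v w => by
    rw [whiskerRight_tmul]; simp
  whiskerLeft_add f g := hom_ext <| tensor_ext fun v w => by
    rw [whiskerLeft_tmul]; simp; rfl
  add_whiskerRight f g := hom_ext <| tensor_ext fun v w => by
    rw [whiskerRight_tmul]; simp; rfl

instance : MonoidalLinear k (GVec ω) where
  whiskerLeft_smul V _ _ c f := hom_ext <| tensor_ext fun v w => by
    rw [whiskerLeft_tmul]; simp; rfl
  smul_whiskerRight c _ _ f V := hom_ext <| tensor_ext fun v w => by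
    rw [whiskerRight_tmul]; simp; rfl

/-! Coequalizers -/

/-- The coequalizer of `f` and `g`: the quotient by the image of `f - g`. -/
noncomputable def coeq {V W : GVec ω} (f g : V ⟶ W) : GVec ω where
  carrier := W.carrier ⧸ LinearMap.range (f.hom - g.hom)
  proj x := Submodule.mapQ _ _ (W.proj x) (by
    rintro _ ⟨v, rfl⟩
    exact ⟨V.proj x v, by simp [f.comm, g.comm]⟩)
  complete := mk_complete
    (fun x y t => by
      obtain ⟨w, rfl⟩ := Submodule.Quotient.mk_surjective _ t
      simp only [Submodule.mapQ_apply, proj_proj]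
      split_ifs <;> simp)
    (fun t => by
      obtain ⟨w, rfl⟩ := Submodule.Quotient.mk_surjective _ t
      simp only [Submodule.mapQ_apply]
      conv_rhs => rw [← W.sum_proj w]
      exact (map_sum (Submodule.mkQ _) _ _).symm)

/-- The projection onto the coequalizer. -/
noncomputable def coeqπ {V W : GVec ω} (f g : V ⟶ W) : W ⟶ coeq f g where
  hom := Submodule.mkQ _
  comm _ _ := rfl

lemma coeq_condition {V W : GVec ω} (f g : V ⟶ W) : f ≫ coeqπ f g = g ≫ coeqπ f g :=
  hom_ext' fun v => (Submodule.Quotient.eq _).2 ⟨v, rfl⟩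

/-- The universal property of the coequalizer. -/
noncomputable def coeqIsColimit {V W : GVec ω} (f g : V ⟶ W) :
    IsColimit (Cofork.ofπ (coeqπ f g) (coeq_condition f g)) :=
  Cofork.IsColimit.mk _
    (fun s =>
      { hom := Submodule.liftQ _ s.π.hom (by
          rintro _ ⟨v, rfl⟩
          have h := congrArg (fun h => h.hom v) s.condition
          simp only [comp_hom, LinearMap.comp_apply] at h
          simp [h])
        comm := fun x t => by
          obtain ⟨w, rfl⟩ := Submodule.Quotient.mk_surjective _ t
          exact s.π.comm x w })
    (fun s => hom_ext' fun v => rfl)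
    (fun s m hm => hom_ext' fun t => by
      obtain ⟨w, rfl⟩ := Submodule.Quotient.mk_surjective _ t
      exact congrArg (fun h => h.hom w) hm)

instance : HasCoequalizers (GVec ω) :=
  have : ∀ {V W : GVec ω} {f g : V ⟶ W}, HasColimit (parallelPair f g) :=
    fun {_ _ f g} => ⟨⟨⟨_, coeqIsColimit f g⟩⟩⟩
  hasCoequalizers_of_hasColimit_parallelPair _

/-! Tensor products preserve colimits, since they have right adjoints given by graded spaces of
linear maps. -/

/-- The projections of the grading on the space of linear maps `U → W` for which `φ` has degree `x`
if it maps `U_a` to `W_{a x}` for all `a`. -/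
noncomputable def lhomProj (U W : GVec ω) (x : G) : Module.End k (U.carrier →ₗ[k] W.carrier) where
  toFun φ := ∑ a, W.proj (a * x) ∘ₗ φ ∘ₗ U.proj a
  map_add' φ φ' := by simp [LinearMap.add_comp, LinearMap.comp_add, Finset.sum_add_distrib]
  map_smul' c φ := by simp [LinearMap.smul_comp, LinearMap.comp_smul, Finset.smul_sum]

lemma lhomProj_apply (U W : GVec ω) (x : G) (φ : U.carrier →ₗ[k] W.carrier) {a : G}
    {u : U.carrier} (hu : u ∈ U.component a) :
    lhomProj U W x φ u = W.proj (a * x) (φ u) := by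
  change (∑ a, W.proj (a * x) ∘ₗ φ ∘ₗ U.proj a) u = _
  rw [LinearMap.sum_apply, Finset.sum_eq_single a _ (by simp)]
  · simp [proj_of_mem U hu]
  · intro b _ hb
    simp [proj_of_mem U hu, hb]

/-- The graded space of linear maps `U → W`, right adjoint to tensoring with `U`. -/
noncomputable def lhom (U W : GVec ω) : GVec ω where
  carrier := U.carrier →ₗ[k] W.carrier
  proj := lhomProj U W
  complete := mk_complete
    (fun x y φ => ext_component fun a u hu => by
      rw [lhomProj_apply _ _ _ _ hu, lhomProj_apply _ _ _ _ hu, proj_proj]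
      by_cases h : x = y
      · simp [h, lhomProj_apply _ _ _ _ hu]
      · simp [h])
    (fun φ => ext_component fun a u hu => by
      rw [LinearMap.sum_apply]
      simp only [lhomProj_apply _ _ _ _ hu]
      rw [← W.sum_proj (φ u)]
      conv_rhs => rw [← Equiv.sum_comp (Equiv.mulLeft a)]
      simp [sum_proj])

/-- The bijection of the tensor-hom adjunction. -/
noncomputable def lhomEquiv (U V W : GVec ω) : (U ⊗ V ⟶ W) ≃ (V ⟶ lhom U W) where
  toFun f :=
    { hom := (show V.carrier →ₗ[k] U.carrier →ₗ[k] W.carrier from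
        LinearMap.mk₂ k (fun v u => f.hom (tmul u v)) (by simp) (by simp) (by simp) (by simp))
      comm := fun x v => by
        refine ext_component (V := U) fun a u hu => ?_
        refine Eq.trans ?_ (lhomProj_apply U W x _ hu).symm
        have h := f.comm (a * x) (tmul u v)
        erw [tensor_proj_tmul_left hu] at h
        rw [inv_mul_cancel_left] at h
        exact h }
  invFun g :=
    let F : (tensor U V).carrier →ₗ[k] W.carrier := TensorProduct.lift (g.hom.flip)
    { hom := F
      comm := fun x t => by
        have : F ∘ₗ (tensor U V).proj x = W.proj x ∘ₗ F := tensor_ext₂ fun a u hu b v hv => by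
          have hF : ∀ u v, F (tmul u v) = (show U.carrier →ₗ[k] W.carrier from g.hom v) u :=
            fun _ _ => rfl
          have hg : (show U.carrier →ₗ[k] W.carrier from g.hom v) u ∈ W.component (a * b) := by
            rw [mem_component_iff, ← lhomProj_apply U W b _ hu]
            have h := g.comm b v
            rw [(mem_component_iff V).1 hv] at h
            exact congrArg (fun φ : U.carrier →ₗ[k] W.carrier => φ u) h.symm
          rw [LinearMap.comp_apply, LinearMap.comp_apply, hF, proj_of_mem W hg,
            proj_of_mem _ (tmul_mem hu hv)]
          split_ifs
          · rfl
          · rw [map_zero]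
        exact congrArg (fun f => f t) this }
  left_inv f := hom_ext <| tensor_ext fun _ _ => rfl
  right_inv g := rfl

instance (U : GVec ω) : PreservesColimitsOfSize.{0, 0} (tensorLeft U) :=
  (Adjunction.adjunctionOfEquivRight (F := tensorLeft U) (lhomEquiv U)
    (fun _ _ _ _ _ => rfl)).leftAdjoint_preservesColimits

/-- The projections of the grading on the space of linear maps `U → W` for which `φ` has degree `x`
if it maps `U_a` to `W_{x a}` for all `a`. -/
noncomputable def rhomProj (U W : GVec ω) (x : G) : Module.End k (U.carrier →ₗ[k] W.carrier) where
  toFun φ := ∑ a, W.proj (x * a) ∘ₗ φ ∘ₗ U.proj a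
  map_add' φ φ' := by simp [LinearMap.add_comp, LinearMap.comp_add, Finset.sum_add_distrib]
  map_smul' c φ := by simp [LinearMap.smul_comp, LinearMap.comp_smul, Finset.smul_sum]

lemma rhomProj_apply (U W : GVec ω) (x : G) (φ : U.carrier →ₗ[k] W.carrier) {a : G}
    {u : U.carrier} (hu : u ∈ U.component a) :
    rhomProj U W x φ u = W.proj (x * a) (φ u) := by
  change (∑ a, W.proj (x * a) ∘ₗ φ ∘ₗ U.proj a) u = _
  rw [LinearMap.sum_apply, Finset.sum_eq_single a _ (by simp)]
  · simp [proj_of_mem U hu]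
  · intro b _ hb
    simp [proj_of_mem U hu, hb]

/-- The graded space of linear maps `U → W`, right adjoint to tensoring with `U`. -/
noncomputable def rhom (U W : GVec ω) : GVec ω where
  carrier := U.carrier →ₗ[k] W.carrier
  proj := rhomProj U W
  complete := mk_complete
    (fun x y φ => ext_component fun a u hu => by
      rw [rhomProj_apply _ _ _ _ hu, rhomProj_apply _ _ _ _ hu, proj_proj]
      by_cases h : x = y
      · simp [h, rhomProj_apply _ _ _ _ hu]
      · simp [h])
    (fun φ => ext_component fun a u hu => by
      rw [LinearMap.sum_apply]
      simp only [rhomProj_apply _ _ _ _ hu]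
      rw [← W.sum_proj (φ u)]
      conv_rhs => rw [← Equiv.sum_comp (Equiv.mulRight a)]
      simp [sum_proj])

/-- The bijection of the tensor-hom adjunction. -/
noncomputable def rhomEquiv (U V W : GVec ω) : (V ⊗ U ⟶ W) ≃ (V ⟶ rhom U W) where
  toFun f :=
    { hom := (show V.carrier →ₗ[k] U.carrier →ₗ[k] W.carrier from
        LinearMap.mk₂ k (fun v u => f.hom (tmul v u)) (by simp) (by simp) (by simp) (by simp))
      comm := fun x v => by
        refine ext_component (V := U) fun a u hu => ?_
        refine Eq.trans ?_ (rhomProj_apply U W x _ hu).symm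
        have h := f.comm (x * a) (tmul v u)
        erw [tensor_proj_tmul_right hu] at h
        rw [mul_inv_cancel_right] at h
        exact h }
  invFun g :=
    let F : (tensor V U).carrier →ₗ[k] W.carrier := TensorProduct.lift (g.hom)
    { hom := F
      comm := fun x t => by
        have : F ∘ₗ (tensor V U).proj x = W.proj x ∘ₗ F := tensor_ext₂ fun b v hv a u hu => by
          have hF : ∀ u v, F (tmul v u) = (show U.carrier →ₗ[k] W.carrier from g.hom v) u :=
            fun _ _ => rfl
          have hg : (show U.carrier →ₗ[k] W.carrier from g.hom v) u ∈ W.component (b * a) := by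
            rw [mem_component_iff, ← rhomProj_apply U W b _ hu]
            have h := g.comm b v
            rw [(mem_component_iff V).1 hv] at h
            exact congrArg (fun φ : U.carrier →ₗ[k] W.carrier => φ u) h.symm
          rw [LinearMap.comp_apply, LinearMap.comp_apply, hF, proj_of_mem W hg,
            proj_of_mem _ (tmul_mem hv hu)]
          split_ifs
          · rfl
          · rw [map_zero]
        exact congrArg (fun f => f t) this }
  left_inv f := hom_ext <| tensor_ext fun _ _ => rfl
  right_inv g := rfl

instance (U : GVec ω) : PreservesColimitsOfSize.{0, 0} (tensorRight U) :=
  (Adjunction.adjunctionOfEquivRight (F := tensorRight U) (rhomEquiv U)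
    (fun _ _ _ _ _ => rfl)).leftAdjoint_preservesColimits

end GVec

/-- A normalized 2-cochain `θ : L × L → kˣ` with `dθ = ω|_L`. In particular the class of `ω|_L` is
trivial. -/
structure TwoCochain (ω : ThreeCocycle k G) (L : Subgroup G) where
  toFun : L → L → kˣ
  coboundary : ∀ a b c : L, toFun a (b * c) * toFun b c = ω a b c * toFun (a * b) c * toFun a b
  one_left : ∀ a : L, toFun 1 a = 1
  one_right : ∀ a : L, toFun a 1 = 1

instance (ω : ThreeCocycle k G) (L : Subgroup G) : CoeFun (TwoCochain ω L) (fun _ => L → L → kˣ) :=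
  ⟨TwoCochain.toFun⟩

/-- The object `⨁ g ∈ L, δ_g` of `Vec_G^ω`. -/
noncomputable def groupObj (ω : ThreeCocycle k G) (L : Subgroup G) : GVec ω where
  carrier := L →₀ k
  proj x := Finsupp.linearCombination k fun g : L => if x = g then Finsupp.single g 1 else 0
  complete := by
    apply GVec.mk_complete
    · intro x y v
      induction v using Finsupp.induction_linear with
      | zero => simp
      | add v w hv hw =>
        rw [map_add, map_add, hv, hw]
        split_ifs <;> simp
      | single g c =>
        by_cases hy : y = g
        · subst hy
          by_cases hx : x = g <;> simp [hx]
        · simp [hy]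
    · intro v
      induction v using Finsupp.induction_linear with
      | zero => simp
      | add v w hv hw => simp only [map_add, Finset.sum_add_distrib, hv, hw]
      | single g c => simp [Finsupp.linearCombination_single]

/-- The basis vector `δ_g` of `⨁ g ∈ L, δ_g`, homogeneous of degree `g`. -/
noncomputable def δ (ω : ThreeCocycle k G) {L : Subgroup G} (g : L) : (groupObj ω L).carrier :=
  (Finsupp.single g 1 : L →₀ k)

section GroupAlgebra

variable {ω : ThreeCocycle k G} {L : Subgroup G}

/-- The linear map on `⨁ g ∈ L, δ_g` with prescribed values on the basis. -/
noncomputable def groupObjLift {V : Type*} [AddCommGroup V] [Module k V] (f : L → V) :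
    (groupObj ω L).carrier →ₗ[k] V :=
  Finsupp.linearCombination k f

lemma groupObjLift_δ {V : Type*} [AddCommGroup V] [Module k V] (f : L → V) (g : L) :
    groupObjLift f (δ ω g) = f g := by
  change Finsupp.linearCombination k f (Finsupp.single g 1) = f g
  simp

lemma groupObj_ext {V : Type*} [AddCommGroup V] [Module k V]
    {f f' : (groupObj ω L).carrier →ₗ[k] V} (h : ∀ g, f (δ ω g) = f' (δ ω g)) : f = f' :=
  (Finsupp.basisSingleOne : Module.Basis L k (L →₀ k)).ext fun g => by
    rw [Finsupp.coe_basisSingleOne]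
    exact h g

lemma δ_mem (g : L) : δ ω g ∈ (groupObj ω L).component g := by
  rw [GVec.mem_component_iff]
  change Finsupp.linearCombination k (fun h : L => if (g : G) = h then Finsupp.single h (1 : k) else 0)
    (Finsupp.single g 1) = Finsupp.single g 1
  simp

lemma groupObj_proj_δ (x : G) (g : L) :
    (groupObj ω L).proj x (δ ω g) = if x = g then δ ω g else 0 :=
  GVec.proj_of_mem _ (δ_mem g)

/-- The multiplication `δ_g ⊗ δ_h ↦ ψ(g, h) δ_{gh}`. -/
noncomputable def groupAlgMul (ψ : TwoCochain ω L) :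
    groupObj ω L ⊗ groupObj ω L ⟶ groupObj ω L :=
  let F : (GVec.tensor (groupObj ω L) (groupObj ω L)).carrier →ₗ[k] (groupObj ω L).carrier :=
    TensorProduct.lift (groupObjLift fun g => groupObjLift fun h => (ψ g h : k) • δ ω (g * h))
  { hom := F
    comm := fun x t => by
      have hF : ∀ g h, F (GVec.tmul (δ ω g) (δ ω h)) = (ψ g h : k) • δ ω (g * h) := fun g h => by
        change groupObjLift (fun g => groupObjLift fun h => (ψ g h : k) • δ ω (g * h)) (δ ω g)
          (δ ω h) = _
        rw [groupObjLift_δ, groupObjLift_δ]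
      have : F ∘ₗ (GVec.tensor (groupObj ω L) (groupObj ω L)).proj x =
          (groupObj ω L).proj x ∘ₗ F := by
        refine GVec.tensor_ext_right fun v => groupObj_ext fun h => ?_
        revert v
        refine fun v => congrArg (fun f => f v) (groupObj_ext (f := (F ∘ₗ
          (GVec.tensor (groupObj ω L) (groupObj ω L)).proj x) ∘ₗ GVec.tmul.flip (δ ω h))
          (f' := ((groupObj ω L).proj x ∘ₗ F) ∘ₗ GVec.tmul.flip (δ ω h)) fun g => ?_)
        change F ((GVec.tensor (groupObj ω L) (groupObj ω L)).proj x
          (GVec.tmul (δ ω g) (δ ω h))) = (groupObj ω L).proj x (F (GVec.tmul (δ ω g) (δ ω h)))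
        rw [GVec.proj_of_mem _ (GVec.tmul_mem (δ_mem g) (δ_mem h)), hF, map_smul,
          groupObj_proj_δ]
        by_cases hx : x = g * h
        · simp [hx, hF]
        · simp [hx]
      exact congrArg (fun f => f t) this }

lemma groupAlgMul_δ (ψ : TwoCochain ω L) (g h : L) :
    (groupAlgMul ψ).hom (GVec.tmul (δ ω g) (δ ω h)) = (ψ g h : k) • δ ω (g * h) := by
  change groupObjLift (fun g => groupObjLift fun h => (ψ g h : k) • δ ω (g * h)) (δ ω g)
    (δ ω h) = _
  rw [groupObjLift_δ, groupObjLift_δ]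

/-- The unit `δ_e ↦ δ_e`. -/
noncomputable def groupAlgUnit (ω : ThreeCocycle k G) (L : Subgroup G) :
    𝟙_ (GVec ω) ⟶ groupObj ω L where
  hom := LinearMap.toSpanSingleton k (groupObj ω L).carrier (δ ω 1)
  comm := GVec.comm_of_mem (V := GVec.unit ω) (W := groupObj ω L) _ fun x c hc => by
    rw [GVec.mem_component_iff] at hc ⊢
    change (groupObj ω L).proj x ((show k from c) • δ ω 1) = (show k from c) • δ ω 1
    rw [map_smul, groupObj_proj_δ]
    change (if x = 1 then (LinearMap.id : k →ₗ[k] k) else 0) c = c at hc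
    by_cases hx : x = 1
    · simp [hx]
    · rw [if_neg hx] at hc
      rw [← hc]
      change (0 : k) • _ = (0 : k) • _
      rw [zero_smul, zero_smul]

lemma groupAlgUnit_apply (c : k) :
    (groupAlgUnit ω L).hom c = c • δ ω 1 := rfl

lemma groupObj_assoc (g h l : L) :
    (α_ (groupObj ω L) (groupObj ω L) (groupObj ω L)).hom.hom
      (GVec.tmul (GVec.tmul (δ ω g) (δ ω h)) (δ ω l)) =
      (((ω g h l)⁻¹ : kˣ) : k) • GVec.tmul (δ ω g) (GVec.tmul (δ ω h) (δ ω l)) :=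
  GVec.associator_tmul (δ_mem g) (δ_mem h) (δ_mem l)

/-- The twisted group algebra `A(L, ψ)`, as an algebra in `Vec_G^ω`. -/
noncomputable def twistedGroupAlg (ψ : TwoCochain ω L) : Mon (GVec ω) where
  X := groupObj ω L
  mon :=
    { one := groupAlgUnit ω L
      mul := groupAlgMul ψ
      one_mul := by
        refine GVec.hom_ext <| GVec.tensor_ext_right (V := GVec.unit ω) fun c =>
          groupObj_ext fun g => ?_
        change (groupAlgMul ψ).hom (GVec.tmul ((show k from c) • δ ω 1) (δ ω g)) =
          (show k from c) • δ ω g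
        rw [map_smul, LinearMap.smul_apply, map_smul, groupAlgMul_δ, ψ.one_left, one_mul,
          Units.val_one, one_smul]
      mul_one := by
        refine GVec.hom_ext <| GVec.tensor_ext_left (W := GVec.unit ω) fun c =>
          groupObj_ext fun g => ?_
        change (groupAlgMul ψ).hom (GVec.tmul (δ ω g) ((show k from c) • δ ω 1)) =
          (show k from c) • δ ω g
        rw [map_smul, map_smul, groupAlgMul_δ, ψ.one_right, mul_one, Units.val_one, one_smul]
      mul_assoc := by
        refine GVec.hom_ext <| GVec.tensor_ext_left fun l => ?_
        refine GVec.tensor_ext_left fun h => groupObj_ext fun g => ?_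
        revert l
        refine fun l => congrArg (fun f => f l) (groupObj_ext
          (f := (groupAlgMul ψ ▷ groupObj ω L ≫ groupAlgMul ψ).hom ∘ₗ
            GVec.tmul (GVec.tmul (δ ω g) h))
          (f' := ((α_ _ _ _).hom ≫ groupObj ω L ◁ groupAlgMul ψ ≫ groupAlgMul ψ).hom ∘ₗ
            GVec.tmul (GVec.tmul (δ ω g) h)) fun l => ?_)
        revert h
        refine fun h => congrArg (fun f => f h) (groupObj_ext
          (f := (groupAlgMul ψ ▷ groupObj ω L ≫ groupAlgMul ψ).hom ∘ₗ
            GVec.tmul.flip (δ ω l) ∘ₗ GVec.tmul (δ ω g))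
          (f' := ((α_ _ _ _).hom ≫ groupObj ω L ◁ groupAlgMul ψ ≫ groupAlgMul ψ).hom ∘ₗ
            GVec.tmul.flip (δ ω l) ∘ₗ GVec.tmul (δ ω g)) fun h => ?_)
        change (groupAlgMul ψ).hom (GVec.tmul ((groupAlgMul ψ).hom (GVec.tmul (δ ω g) (δ ω h)))
            (δ ω l)) =
          (groupAlgMul ψ).hom ((groupObj ω L ◁ groupAlgMul ψ).hom
            ((α_ (groupObj ω L) (groupObj ω L) (groupObj ω L)).hom.hom
              (GVec.tmul (GVec.tmul (δ ω g) (δ ω h)) (δ ω l))))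
        rw [groupObj_assoc, map_smul, GVec.whiskerLeft_tmul]
        simp only [groupAlgMul_δ, map_smul, LinearMap.smul_apply, smul_smul, ← Units.val_mul,
          mul_assoc]
        congr 2
        rw [eq_inv_mul_iff_mul_eq, mul_comm (ψ h l), ψ.coboundary]
        simp only [mul_comm, mul_left_comm] }

end GroupAlgebra

section Hecke

variable {ω : ThreeCocycle k G} {K L : Subgroup G}

/-- The group-theoretical fusion category `C(G, ω, K, β)` of `A(K, β)`-bimodules in `Vec_G^ω`. -/
abbrev GTFusionCat (β : TwoCochain ω K) :=
  Bimod (twistedGroupAlg β) (twistedGroupAlg β)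

/-- The object `A^{K,β}(L, ψ) = (A(K, β) ⊗ A(L, ψ)) ⊗ A(K, β)` of `C(G, ω, K, β)`. -/
noncomputable def twistedHecke (β : TwoCochain ω K) (ψ : TwoCochain ω L) : GTFusionCat β :=
  freeBimod (twistedGroupAlg β) (twistedGroupAlg ψ).X

/-- The basis vector `(δ_f ⊗ δ_g) ⊗ δ_h` of `A^{K,β}(L, ψ)`. -/
noncomputable def heckeBasis (β : TwoCochain ω K) (ψ : TwoCochain ω L) (f : K) (g : L) (h : K) :
    (twistedHecke β ψ).X.carrier :=
  GVec.tmul (GVec.tmul (δ ω f) (δ ω g)) (δ ω h)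

/-- The basis vector `δ_d` of the unit object `A(K, β)` of `C(G, ω, K, β)`. -/
noncomputable def unitBasis (β : TwoCochain ω K) (d : K) : (𝟙_ (GTFusionCat β)).X.carrier :=
  δ ω d

/-- The element `v ⊗_{A(K,β)} w` of `M ⊗_{A(K,β)} N`. -/
noncomputable def tmulOver {β : TwoCochain ω K} {M N : GTFusionCat β} (v : M.X.carrier)
    (w : N.X.carrier) : (M ⊗ N).X.carrier :=
  (bimodProj M N).hom (GVec.tmul v w)

/-- The structure maps of `A^{K,β}(L, ψ)` on basis vectors: the multiplication, the unit, the
comultiplication and the counit of the given algebra and coalgebra structure are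
* `b(f,g,h) ⊗ b(f',g',h') ↦ δ_{hf',e} ω(fgh,f'g',h') ω⁻¹(fg,h,f'g') ω(h,f',g') ω⁻¹(f,g,g') β(h,f')
  ψ(g,g') b(f,gg',h')`,
* `δ_d ↦ ∑ s ∈ K, β⁻¹(ds⁻¹,s) b(ds⁻¹,e,s)`,
* `b(f,g,h) ↦ |K|⁻¹ |L|⁻¹ ∑ t ∈ L, s ∈ K, ω(f,gt,t⁻¹) ω(fgt,s,s⁻¹t⁻¹) ω⁻¹(fgts,s⁻¹t⁻¹,h)
  ω⁻¹(s,s⁻¹,t⁻¹) ψ⁻¹(gt,t⁻¹) β⁻¹(s,s⁻¹) b(f,gt,s) ⊗ b(s⁻¹,t⁻¹,h)`,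
* `b(f,g,h) ↦ δ_{g,e} |L| β(f,h) δ_{fh}`,

where `b(f,g,h) = (δ_f ⊗ δ_g) ⊗ δ_h` and `⊗` is the tensor product over `A(K, β)`. -/
structure IsHeckeStructure (β : TwoCochain ω K) (ψ : TwoCochain ω L)
    [MonObj (twistedHecke β ψ)] [ComonObj (twistedHecke β ψ)] : Prop where
  mul (f f' h h' : K) (g g' : L) :
    (μ[twistedHecke β ψ]).hom.hom
        (tmulOver (heckeBasis β ψ f g h) (heckeBasis β ψ f' g' h')) =
      if h * f' = 1 then
        ((ω (f * g * h) (f' * g') h' * (ω (f * g) h (f' * g'))⁻¹ * ω h f' g' * (ω f g g')⁻¹ *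
          β h f' * ψ g g' : kˣ) : k) • heckeBasis β ψ f (g * g') h'
      else 0
  unit (d : K) :
    (η[twistedHecke β ψ]).hom.hom (unitBasis β d) =
      ∑ s : K, (((β (d * s⁻¹) s)⁻¹ : kˣ) : k) • heckeBasis β ψ (d * s⁻¹) 1 s
  comul (f h : K) (g : L) :
    (Δ[twistedHecke β ψ]).hom.hom (heckeBasis β ψ f g h) =
      ((Nat.card K : k)⁻¹ * (Nat.card L : k)⁻¹) • ∑ t : L, ∑ s : K,
        ((ω f (g * t) (t : G)⁻¹ * ω (f * g * t) s ((s : G)⁻¹ * (t : G)⁻¹) *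
          (ω (f * g * t * s) ((s : G)⁻¹ * (t : G)⁻¹) h)⁻¹ * (ω s (s : G)⁻¹ (t : G)⁻¹)⁻¹ *
          (ψ (g * t) t⁻¹)⁻¹ * (β s s⁻¹)⁻¹ : kˣ) : k) •
            tmulOver (heckeBasis β ψ f (g * t) s) (heckeBasis β ψ s⁻¹ t⁻¹ h)
  counit (f h : K) (g : L) :
    (ε[twistedHecke β ψ]).hom.hom (heckeBasis β ψ f g h) =
      if g = 1 then ((Nat.card L : k) * (β f h : k)) • unitBasis β (f * h) else 0

end Hecke
end GradedSpaces

/-! ### Tensor products over an algebra, tested on `M ⊗ N` -/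

section BimodTensor

variable {C : Type u} [Category.{v} C] [MonoidalCategory C] [HasCoequalizers C]
  [∀ X : C, PreservesColimitsOfSize.{0, 0} (tensorLeft X)]
  [∀ X : C, PreservesColimitsOfSize.{0, 0} (tensorRight X)] {A : Mon C}

/-! The object `A` is the free bimodule on `A(L,ψ)`. A bimodule morphism out of it is therefore the
same as an arbitrary choice of homogeneous images, of degree `g`, for the generators `b(1,g,1)`
(`heckeLift`, `biGenerates_heckeBasis`). In `M ⊗_{A(K,β)} N` all actions can be pushed to the
outside except one copy of `K` in the middle (`BiGenerates.tensor`). Hence an identity of morphisms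
out of `A ⊗ A` need only be checked on `b(1,g,1) ⊗ b(f,g',1)`, and similarly for triple products.
The associativity constraint over `A(K,β)` is again multiplication by `ω⁻¹` on homogeneous elements,
so each axiom becomes an identity between values of `ω`, `β` and `ψ`. Such an identity is a product
of instances of the 3-cocycle equation and of `dβ = ω`, `dψ = ω`; in additive notation it is a
linear combination of them.

The multiplication resembles that of matrices indexed by `K` with entries in `A(L,ψ)`: a product of
basis vectors vanishes unless the third index of the left factor is inverse to the first index of
the right one. The coefficients of the comultiplication at `b(1,g,1)` are, up to the factor
`1/(|K||L|)`, the inverses of the structure constants of the products `b(1,gt,s) b(s⁻¹,t⁻¹,1)`. So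
`mΔ` is a sum of `|K||L|` copies of the identity divided by `|K||L|`, which makes sense in
characteristic `0`. The two Frobenius relations (`heckeFrobenius_left`, `heckeFrobenius_right`) are
verified directly. They imply coassociativity (`coassoc_of_frobenius`), and together with `mΔ = id`
they make `Δ` itself a separating section.

For indecomposability, put `e = b(1,1,1)`. It behaves like a diagonal matrix unit, and the corner `e
A e` is spanned by the `b(1,g,1)`, whose only part of degree `1` is the line through `e`. The
projection onto an algebra summand commutes with multiplication on both sides, so it sends `e` to a
multiple `c e`. Since `e b(1,g,1) = b(1,g,1)`, the projection is `c` times the identity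
(`hecke_endomorphism_eq_smul`). Idempotence leaves `c = 0` or `c = 1`, and one summand is zero. -/

instance epi_bimodProj (M N : Bimod A A) : Epi (bimodProj M N) := by
  unfold bimodProj
  exact coequalizer.π_epi

theorem bimodProj_balanced (M N : Bimod A A) :
    M.actRight ▷ N.X ≫ bimodProj M N =
      (α_ M.X A.X N.X).hom ≫ M.X ◁ N.actLeft ≫ bimodProj M N :=
  (coequalizer.condition _ _).trans (Category.assoc _ _ _)

theorem bimodProj_actLeft (M N : Bimod A A) :
    A.X ◁ bimodProj M N ≫ (M ⊗ N).actLeft =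
      (α_ A.X M.X N.X).inv ≫ M.actLeft ▷ N.X ≫ bimodProj M N :=
  Bimod.TensorBimod.whiskerLeft_π_actLeft M N

theorem bimodProj_actRight (M N : Bimod A A) :
    bimodProj M N ▷ A.X ≫ (M ⊗ N).actRight =
      (α_ M.X N.X A.X).hom ≫ M.X ◁ N.actRight ≫ bimodProj M N :=
  Bimod.TensorBimod.π_tensor_id_actRight M N

theorem bimodProj_whiskerRight {M M' : Bimod A A} (f : M ⟶ M') (N : Bimod A A) :
    bimodProj M N ≫ (f ▷ N).hom = f.hom ▷ N.X ≫ bimodProj M' N :=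
  (ι_colimMap _ _).trans (by rw [parallelPairHom_app_one]; rfl)

theorem bimodProj_whiskerLeft (M : Bimod A A) {N N' : Bimod A A} (f : N ⟶ N') :
    bimodProj M N ≫ (M ◁ f).hom = M.X ◁ f.hom ≫ bimodProj M N' :=
  (ι_colimMap _ _).trans (by rw [parallelPairHom_app_one]; rfl)

theorem bimodProj_leftUnitor (N : Bimod A A) :
    bimodProj (𝟙_ (Bimod A A)) N ≫ (λ_ N).hom.hom = N.actLeft :=
  coequalizer.π_desc _ _

theorem bimodProj_rightUnitor (N : Bimod A A) :
    bimodProj N (𝟙_ (Bimod A A)) ≫ (ρ_ N).hom.hom = N.actRight :=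
  coequalizer.π_desc _ _

theorem bimodProj_associator (M N P : Bimod A A) :
    bimodProj M N ▷ P.X ≫ bimodProj (M ⊗ N) P ≫ (α_ M N P).hom.hom =
      (α_ M.X N.X P.X).hom ≫ M.X ◁ bimodProj N P ≫ bimodProj M (N ⊗ P) := by
  have h : bimodProj (M ⊗ N) P ≫ (α_ M N P).hom.hom = Bimod.AssociatorBimod.homAux M N P :=
    coequalizer.π_desc _ _
  rw [h]
  -- The associator is defined by two successive descents. The inner one goes through `bimodProj M N
  -- ▷ P.X`, which is still a coequalizer because tensoring with `P.X` preserves colimits.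
  exact π_tensor_id_preserves_coequalizer_inv_desc _ _ _ _

/-- A morphism `M ⊗_A N ⟶ P` is a morphism of bimodules if its composition with the projection
`M ⊗ N ⟶ M ⊗_A N` is compatible with the actions. -/
def bimodHomOfProj {M N P : Bimod A A} (f : M.X ⊗ N.X ⟶ P.X) (g : (M ⊗ N).X ⟶ P.X)
    (hg : bimodProj M N ≫ g = f)
    (hl : (α_ A.X M.X N.X).inv ≫ M.actLeft ▷ N.X ≫ f = A.X ◁ f ≫ P.actLeft)
    (hr : (α_ M.X N.X A.X).hom ≫ M.X ◁ N.actRight ≫ f = f ▷ A.X ≫ P.actRight) :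
    M ⊗ N ⟶ P where
  hom := g
  left_act_hom := by
    -- Tensoring preserves colimits, so the projection stays epi after tensoring with `A` and the
    -- identity may be tested on `A ⊗ (M ⊗ N)`.
    refine (cancel_epi ((tensorLeft A.X).map (bimodProj M N))).1 ?_
    change A.X ◁ bimodProj M N ≫ _ ≫ _ = A.X ◁ bimodProj M N ≫ _ ≫ _
    rw [← Category.assoc, bimodProj_actLeft, ← Category.assoc (A.X ◁ bimodProj M N),
      ← MonoidalCategory.whiskerLeft_comp, hg, ← hl, Category.assoc, Category.assoc, hg]
  right_act_hom := by
    refine (cancel_epi ((tensorRight A.X).map (bimodProj M N))).1 ?_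
    change bimodProj M N ▷ A.X ≫ _ ≫ _ = bimodProj M N ▷ A.X ≫ _ ≫ _
    rw [← Category.assoc, bimodProj_actRight, ← Category.assoc (bimodProj M N ▷ A.X),
      ← MonoidalCategory.comp_whiskerRight, hg, ← hr, Category.assoc, Category.assoc, hg]

/-- The morphism of bimodules `M ⊗_A N ⟶ P` induced by a balanced morphism `M ⊗ N ⟶ P`. -/
noncomputable def bimodDesc {M N P : Bimod A A} (f : M.X ⊗ N.X ⟶ P.X)
    (hb : M.actRight ▷ N.X ≫ f = (α_ M.X A.X N.X).hom ≫ M.X ◁ N.actLeft ≫ f)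
    (hl : (α_ A.X M.X N.X).inv ≫ M.actLeft ▷ N.X ≫ f = A.X ◁ f ≫ P.actLeft)
    (hr : (α_ M.X N.X A.X).hom ≫ M.X ◁ N.actRight ≫ f = f ▷ A.X ≫ P.actRight) :
    M ⊗ N ⟶ P :=
  bimodHomOfProj f (coequalizer.desc f (hb.trans (Category.assoc _ _ _).symm))
    (coequalizer.π_desc _ _) hl hr

theorem bimodProj_desc {M N P : Bimod A A} (f : M.X ⊗ N.X ⟶ P.X)
    (hb : M.actRight ▷ N.X ≫ f = (α_ M.X A.X N.X).hom ≫ M.X ◁ N.actLeft ≫ f)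
    (hl : (α_ A.X M.X N.X).inv ≫ M.actLeft ▷ N.X ≫ f = A.X ◁ f ≫ P.actLeft)
    (hr : (α_ M.X N.X A.X).hom ≫ M.X ◁ N.actRight ≫ f = f ▷ A.X ≫ P.actRight) :
    bimodProj M N ≫ (bimodDesc f hb hl hr).hom = f :=
  coequalizer.π_desc _ _

end BimodTensor

/-! ### Coassociativity from the Frobenius relations -/

section Frobenius

variable {C : Type u} [Category.{v} C] [MonoidalCategory C]

/-- A comultiplication satisfying the Frobenius relations is coassociative. -/
theorem coassoc_of_frobenius (A : C) [MonObj A] (D : A ⟶ A ⊗ A)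
    (h₁ : A ◁ D ≫ (α_ A A A).inv ≫ μ[A] ▷ A = μ[A] ≫ D)
    (h₂ : D ▷ A ≫ (α_ A A A).hom ≫ A ◁ μ[A] = μ[A] ≫ D) :
    D ≫ A ◁ D = D ≫ D ▷ A ≫ (α_ A A A).hom := by
  -- In elements: `D a = (D 1) a`, with `a` multiplied onto the second leg. With `D 1 = ∑ x ⊗ y` and
  -- `D a = ∑ a₁ ⊗ a₂`, this gives `(D ⊗ id) D a = ∑ x ⊗ y a₁ ⊗ a₂`, which by `h₁` equals `∑ x ⊗ D
  -- (y a) = (id ⊗ D) D a`.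
  have hD : D = (λ_ A).inv ≫ (η[A] ≫ D) ▷ A ≫ (α_ A A A).hom ≫ A ◁ μ[A] := by
    rw [comp_whiskerRight, Category.assoc, h₂, MonObj.one_mul_assoc, Iso.inv_hom_id_assoc]
  symm
  calc D ≫ D ▷ A ≫ (α_ A A A).hom
      = D ≫ ((λ_ A).inv ≫ (η[A] ≫ D) ▷ A ≫ (α_ A A A).hom ≫ A ◁ μ[A]) ▷ A ≫
          (α_ A A A).hom := by rw [← hD]
    _ = ((λ_ A).inv ≫ (η[A] ≫ D) ▷ A) ≫ (α_ A A A).hom ≫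
          A ◁ (A ◁ D ≫ (α_ A A A).inv ≫ μ[A] ▷ A) := by
        -- Interchange law: inserting `D 1` on the left and applying `D` to `a` take place on
        -- different tensor factors.
        have e : D ≫ (λ_ A).inv ▷ A ≫ (η[A] ≫ D) ▷ A ▷ A =
            (λ_ A).inv ≫ (η[A] ≫ D) ▷ A ≫ (A ⊗ A) ◁ D ≫ (α_ (A ⊗ A) A A).inv := by
          rw [← whisker_exchange_assoc]
          monoidal
        simp only [comp_whiskerRight, Category.assoc] at e ⊢
        rw [reassoc_of% e]
        monoidal
    _ = (λ_ A).inv ≫ (η[A] ≫ D) ▷ A ≫ (α_ A A A).hom ≫ A ◁ μ[A] ≫ A ◁ D := by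
        rw [h₁]; simp only [MonoidalCategory.whiskerLeft_comp, Category.assoc]
    _ = D ≫ A ◁ D := by
        have h := congrArg (· ≫ A ◁ D) hD
        simp only [Category.assoc] at h
        exact h.symm

end Frobenius

/-! ### Calculus with homogeneous elements in `Vec_G^ω` and its bimodules -/

section GradedBimodules

open scoped Classical

variable {k G : Type u} [Field k] [Group G] [Fintype G] {ω : ThreeCocycle k G}

namespace GVec

lemma associator_inv_tmul {U V W : GVec ω} {x y z : G} {u : U.carrier}
    {v : V.carrier} {w : W.carrier} (hu : u ∈ U.component x) (hv : v ∈ V.component y)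
    (hw : w ∈ W.component z) :
    (α_ U V W).inv.hom (tmul u (tmul v w)) = (ω x y z : k) • tmul (tmul u v) w := by
  have h := associator_tmul hu hv hw
  have h' := congrArg (α_ U V W).inv.hom h
  rw [map_smul] at h'
  have e : (α_ U V W).inv.hom ((α_ U V W).hom.hom (tmul (tmul u v) w)) = tmul (tmul u v) w :=
    congrArg (fun f => Hom.hom f (tmul (tmul u v) w)) (α_ U V W).hom_inv_id
  rw [← e, h', smul_smul, ← Units.val_mul, mul_inv_cancel, Units.val_one, one_smul]

/-- The quotient map onto the cokernel of `f` composes with `f` to zero, so it vanishes when `f` is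
epi, and the image of `f` is everything. -/
lemma surjective_of_epi {V W : GVec ω} (f : V ⟶ W) [Epi f] : Function.Surjective f.hom := by
  have h : coeqπ f 0 = 0 := by
    rw [← cancel_epi f, comp_zero, coeq_condition, zero_comp]
  intro w
  have hw : (coeqπ f 0).hom w = 0 := by rw [h]; rfl
  obtain ⟨v, hv⟩ := (Submodule.Quotient.mk_eq_zero _).1 hw
  exact ⟨v, by simpa using hv⟩

/-- The degree-preserving linear map with prescribed values on a homogeneous basis. -/
noncomputable def homOfBasis {I : Type*} {V W : GVec ω} (b : Module.Basis I k V.carrier)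
    (deg : I → G) (hb : ∀ i, b i ∈ V.component (deg i)) (f : I → W.carrier)
    (hf : ∀ i, f i ∈ W.component (deg i)) : V ⟶ W where
  hom := b.constr k f
  comm x v := by
    have : b.constr k f ∘ₗ V.proj x = W.proj x ∘ₗ b.constr k f := b.ext fun i => by
      rw [LinearMap.comp_apply, LinearMap.comp_apply, proj_of_mem V (hb i), b.constr_basis,
        proj_of_mem W (hf i)]
      split_ifs
      · exact b.constr_basis k f i
      · exact map_zero _
    exact congrArg (fun f => f v) this

lemma homOfBasis_apply {I : Type*} {V W : GVec ω} (b : Module.Basis I k V.carrier)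
    (deg : I → G) (hb : ∀ i, b i ∈ V.component (deg i)) (f : I → W.carrier)
    (hf : ∀ i, f i ∈ W.component (deg i)) (i : I) :
    (homOfBasis b deg hb f hf).hom (b i) = f i :=
  b.constr_basis k f i

/-- The basis of a tensor product given by the products of basis vectors. -/
noncomputable def tensorBasis {I J : Type*} {V W : GVec ω} (b : Module.Basis I k V.carrier)
    (c : Module.Basis J k W.carrier) : Module.Basis (I × J) k (tensor V W).carrier :=
  b.tensorProduct c

lemma tensorBasis_apply {I J : Type*} {V W : GVec ω} (b : Module.Basis I k V.carrier)
    (c : Module.Basis J k W.carrier) (p : I × J) :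
    tensorBasis b c p = tmul (b p.1) (c p.2) :=
  Module.Basis.tensorProduct_apply' b c p

/-- The degree-preserving map on a tensor product with prescribed values on products of
homogeneous basis vectors. -/
noncomputable def homOfBasis₂ {I J : Type*} {V W Z : GVec ω} (b : Module.Basis I k V.carrier)
    (c : Module.Basis J k W.carrier) (deg : I → G) (deg' : J → G)
    (hb : ∀ i, b i ∈ V.component (deg i)) (hc : ∀ j, c j ∈ W.component (deg' j))
    (f : I → J → Z.carrier) (hf : ∀ i j, f i j ∈ Z.component (deg i * deg' j)) : V ⊗ W ⟶ Z :=
  homOfBasis (V := tensor V W) (tensorBasis b c) (fun p => deg p.1 * deg' p.2)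
    (fun p => by
      rw [tensorBasis_apply]
      exact tmul_mem (hb p.1) (hc p.2))
    (fun p => f p.1 p.2) fun p => hf p.1 p.2

lemma homOfBasis₂_apply {I J : Type*} {V W Z : GVec ω} (b : Module.Basis I k V.carrier)
    (c : Module.Basis J k W.carrier) (deg : I → G) (deg' : J → G)
    (hb : ∀ i, b i ∈ V.component (deg i)) (hc : ∀ j, c j ∈ W.component (deg' j))
    (f : I → J → Z.carrier) (hf : ∀ i j, f i j ∈ Z.component (deg i * deg' j)) (i : I) (j : J) :
    (homOfBasis₂ b c deg deg' hb hc f hf).hom (tmul (b i) (c j)) = f i j := by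
  have h : tmul (b i) (c j) = tensorBasis b c (i, j) :=
    (tensorBasis_apply b c (i, j)).symm
  rw [h]
  exact homOfBasis_apply (V := tensor V W) _ _ _ _ _ (i, j)

lemma hom_eq_smul {V W : GVec ω} (f : V ⟶ W) {c : k} {v v' : V.carrier} (h : v = c • v') :
    f.hom v = c • f.hom v' := by
  rw [h, map_smul]

lemma smul_eq_iff {V : GVec ω} {c : kˣ} {v w : V.carrier} :
    ((c⁻¹ : kˣ) : k) • v = w ↔ v = (c : k) • w := by
  constructor
  · rintro rfl
    rw [smul_smul, ← Units.val_mul, mul_inv_cancel, Units.val_one, one_smul]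
  · rintro rfl
    rw [smul_smul, ← Units.val_mul, inv_mul_cancel, Units.val_one, one_smul]

end GVec

open GVec

/-! ### Actions of the basis vectors of `A(K,β)` on a bimodule -/

variable {K : Subgroup G} {β : TwoCochain ω K}

/-- The left action of `δ_d` on a bimodule over `A(K, β)`. -/
noncomputable def lact (N : GTFusionCat β) (d : K) : Module.End k N.X.carrier :=
  N.actLeft.hom ∘ₗ tmul (V := groupObj ω K) (δ ω d)

/-- The right action of `δ_d` on a bimodule over `A(K, β)`. -/
noncomputable def ract (N : GTFusionCat β) (d : K) : Module.End k N.X.carrier :=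
  N.actRight.hom ∘ₗ (tmul (W := groupObj ω K)).flip (δ ω d)

lemma lact_mem {N : GTFusionCat β} {x : G} {n : N.X.carrier} (hn : n ∈ N.X.component x) (d : K) :
    lact N d n ∈ N.X.component (d * x) :=
  hom_mem_component N.actLeft (tmul_mem (δ_mem d) hn)

lemma ract_mem {N : GTFusionCat β} {x : G} {n : N.X.carrier} (hn : n ∈ N.X.component x) (d : K) :
    ract N d n ∈ N.X.component (x * d) :=
  hom_mem_component N.actRight (tmul_mem hn (δ_mem d))

lemma lact_one (N : GTFusionCat β) (n : N.X.carrier) : lact N 1 n = n := by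
  have h := congrArg (fun f => GVec.Hom.hom f (tmul (V := unit ω) (1 : k) n)) N.one_actLeft
  refine Eq.trans ?_ (h.trans (one_smul k n))
  change _ = N.actLeft.hom (tmul ((1 : k) • δ ω 1) n)
  rw [one_smul]
  rfl

lemma ract_one (N : GTFusionCat β) (n : N.X.carrier) : ract N 1 n = n := by
  have h := congrArg (fun f => GVec.Hom.hom f (tmul (W := unit ω) n (1 : k))) N.actRight_one
  refine Eq.trans ?_ (h.trans (one_smul k n))
  change _ = N.actRight.hom (tmul n ((1 : k) • δ ω 1))
  rw [one_smul]
  rfl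

/-- The factor `ω` comes from rebracketing `(δ_c ⊗ δ_d) ⊗ n`, the factor `β` from the product in
`A(K,β)`. Thus `K` acts only up to scalars, and these depend on the degree of `n`. -/
lemma lact_lact {N : GTFusionCat β} {x : G} {n : N.X.carrier} (hn : n ∈ N.X.component x)
    (c d : K) : lact N c (lact N d n) = ((ω c d x * β c d : kˣ) : k) • lact N (c * d) n := by
  have h := congrArg (fun f => GVec.Hom.hom f (tmul (tmul (δ ω c) (δ ω d)) n)) N.left_assoc
  have h₁ : N.actLeft.hom (tmul ((groupAlgMul β).hom (tmul (δ ω c) (δ ω d))) n) =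
      (((ω c d x)⁻¹ : kˣ) : k) • lact N c (lact N d n) :=
    Eq.trans h (hom_eq_smul N.actLeft (hom_eq_smul ((twistedGroupAlg β).X ◁ N.actLeft)
      (associator_tmul (δ_mem c) (δ_mem d) hn)))
  have h₂ : N.actLeft.hom (tmul ((groupAlgMul β).hom (tmul (δ ω c) (δ ω d))) n) =
      (β c d : k) • lact N (c * d) n :=
    hom_eq_smul N.actLeft (by rw [groupAlgMul_δ, map_smul, LinearMap.smul_apply]; rfl)
  rw [Units.val_mul, mul_smul, ← h₂, h₁, smul_smul, ← Units.val_mul, mul_inv_cancel,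
    Units.val_one, one_smul]

lemma ract_ract {N : GTFusionCat β} {x : G} {n : N.X.carrier} (hn : n ∈ N.X.component x)
    (c d : K) :
    ract N d (ract N c n) = (((ω x c d)⁻¹ * β c d : kˣ) : k) • ract N (c * d) n := by
  have h := congrArg (fun f => GVec.Hom.hom f (tmul n (tmul (δ ω c) (δ ω d)))) N.right_assoc
  have h₁ : N.actRight.hom (tmul n ((groupAlgMul β).hom (tmul (δ ω c) (δ ω d)))) =
      (ω x c d : k) • ract N d (ract N c n) :=
    Eq.trans h (hom_eq_smul N.actRight (hom_eq_smul (N.actRight ▷ (twistedGroupAlg β).X)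
      (associator_inv_tmul hn (δ_mem c) (δ_mem d))))
  have h₂ : N.actRight.hom (tmul n ((groupAlgMul β).hom (tmul (δ ω c) (δ ω d)))) =
      (β c d : k) • ract N (c * d) n :=
    hom_eq_smul N.actRight ((congrArg (tmul n) (groupAlgMul_δ β c d)).trans
      ((tmul n).map_smul _ _))
  rw [Units.val_mul, mul_smul, ← h₂, h₁, smul_smul, ← Units.val_mul, inv_mul_cancel,
    Units.val_one, one_smul]

lemma ract_lact {N : GTFusionCat β} {x : G} {n : N.X.carrier} (hn : n ∈ N.X.component x)
    (c d : K) :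
    ract N d (lact N c n) = (((ω c x d)⁻¹ : kˣ) : k) • lact N c (ract N d n) :=
  have h := congrArg (fun f => GVec.Hom.hom f (tmul (tmul (δ ω c) n) (δ ω d))) N.middle_assoc
  Eq.trans h (hom_eq_smul N.actLeft (hom_eq_smul ((twistedGroupAlg β).X ◁ N.actRight)
    (associator_tmul (δ_mem c) hn (δ_mem d))))

lemma lact_ract {N : GTFusionCat β} {x : G} {n : N.X.carrier} (hn : n ∈ N.X.component x)
    (c d : K) :
    lact N c (ract N d n) = (ω c x d : k) • ract N d (lact N c n) := by
  rw [ract_lact hn, smul_smul, ← Units.val_mul, mul_inv_cancel, Units.val_one, one_smul]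

lemma hom_lact {M N : GTFusionCat β} (f : M ⟶ N) (d : K) (m : M.X.carrier) :
    f.hom.hom (lact M d m) = lact N d (f.hom.hom m) :=
  congrArg (fun f => GVec.Hom.hom f (tmul (δ ω d) m)) f.left_act_hom

lemma hom_ract {M N : GTFusionCat β} (f : M ⟶ N) (d : K) (m : M.X.carrier) :
    f.hom.hom (ract M d m) = ract N d (f.hom.hom m) :=
  congrArg (fun f => GVec.Hom.hom f (tmul m (δ ω d))) f.right_act_hom

/-- A morphism of bimodules, from a degree-preserving map that commutes with the actions of
basis vectors. -/
def bimodHomMk {M N : GTFusionCat β} (f : M.X ⟶ N.X)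
    (hl : ∀ d m, f.hom (lact M d m) = lact N d (f.hom m))
    (hr : ∀ d m, f.hom (ract M d m) = ract N d (f.hom m)) : M ⟶ N where
  hom := f
  left_act_hom := GVec.hom_ext <| tensor_ext_left (V := groupObj ω K) fun m =>
    groupObj_ext fun d => hl d m
  right_act_hom := GVec.hom_ext <| tensor_ext_right (W := groupObj ω K) fun m =>
    groupObj_ext fun d => hr d m

/-! ### Elements of the tensor product over `A(K,β)` -/

section TensorOver

variable {M M' N N' P : GTFusionCat β}

/-- The element `v ⊗_{A(K,β)} w`, as a bilinear map. -/
noncomputable def tmulOverₗ (M N : GTFusionCat β) :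
    M.X.carrier →ₗ[k] N.X.carrier →ₗ[k] (M ⊗ N).X.carrier :=
  (tmul (V := M.X) (W := N.X)).compr₂ (bimodProj M N).hom

lemma tmulOver_smul (c : k) (v : M.X.carrier) (w : N.X.carrier) :
    tmulOver v (c • w) = c • tmulOver v w :=
  (tmulOverₗ M N v).map_smul c w

lemma smul_tmulOver (c : k) (v : M.X.carrier) (w : N.X.carrier) :
    tmulOver (c • v) w = c • tmulOver v w :=
  (tmulOverₗ M N).map_smul₂ c v w

lemma tmulOver_zero (v : M.X.carrier) : tmulOver v (0 : N.X.carrier) = 0 :=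
  (tmulOverₗ M N v).map_zero

lemma zero_tmulOver (w : N.X.carrier) : tmulOver (0 : M.X.carrier) w = 0 :=
  (tmulOverₗ M N).map_zero₂ w

lemma tmulOver_sum {I : Type*} (s : Finset I) (v : M.X.carrier) (w : I → N.X.carrier) :
    tmulOver v (∑ i ∈ s, w i) = ∑ i ∈ s, tmulOver v (w i) :=
  map_sum (tmulOverₗ M N v) w s

lemma sum_tmulOver {I : Type*} (s : Finset I) (v : I → M.X.carrier) (w : N.X.carrier) :
    tmulOver (∑ i ∈ s, v i) w = ∑ i ∈ s, tmulOver (v i) w :=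
  map_sum ((tmulOverₗ M N).flip w) v s

lemma tmulOver_mem {x y : G} {v : M.X.carrier} {w : N.X.carrier} (hv : v ∈ M.X.component x)
    (hw : w ∈ N.X.component y) : tmulOver v w ∈ (M ⊗ N).X.component (x * y) :=
  hom_mem_component (bimodProj M N) (tmul_mem hv hw)

lemma tmulOver_ext {Z : Type*} [AddCommGroup Z] [Module k Z] {f g : (M ⊗ N).X.carrier →ₗ[k] Z}
    (h : ∀ v w, f (tmulOver v w) = g (tmulOver v w)) : f = g := by
  have : f ∘ₗ (bimodProj M N).hom = g ∘ₗ (bimodProj M N).hom :=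
    tensor_ext (V := M.X) (W := N.X) h
  ext t
  obtain ⟨s, rfl⟩ := surjective_of_epi (bimodProj M N) t
  exact congrArg (fun f => f s) this

/-- The balancing relation compares the two actions only after rebracketing `(v ⊗ δ_d) ⊗ w`, which
is where the value of `ω` enters. -/
lemma tmulOver_ract {x y : G} {v : M.X.carrier} {w : N.X.carrier} (hv : v ∈ M.X.component x)
    (hw : w ∈ N.X.component y) (d : K) :
    tmulOver (ract M d v) w = (((ω x d y)⁻¹ : kˣ) : k) • tmulOver v (lact N d w) :=
  have h := congrArg (fun f => GVec.Hom.hom f (tmul (tmul v (δ ω d)) w)) (bimodProj_balanced M N)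
  Eq.trans h (hom_eq_smul (bimodProj M N) (hom_eq_smul (M.X ◁ N.actLeft)
    (associator_tmul hv (δ_mem d) hw)))

lemma lact_tmulOver {x y : G} {v : M.X.carrier} {w : N.X.carrier} (hv : v ∈ M.X.component x)
    (hw : w ∈ N.X.component y) (d : K) :
    lact (M ⊗ N) d (tmulOver v w) = (ω d x y : k) • tmulOver (lact M d v) w :=
  have h := congrArg (fun f => GVec.Hom.hom f (tmul (δ ω d) (tmul v w))) (bimodProj_actLeft M N)
  Eq.trans h (hom_eq_smul (bimodProj M N) (hom_eq_smul (M.actLeft ▷ N.X)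
    (associator_inv_tmul (δ_mem d) hv hw)))

lemma ract_tmulOver {x y : G} {v : M.X.carrier} {w : N.X.carrier} (hv : v ∈ M.X.component x)
    (hw : w ∈ N.X.component y) (d : K) :
    ract (M ⊗ N) d (tmulOver v w) = (((ω x y d)⁻¹ : kˣ) : k) • tmulOver v (ract N d w) :=
  have h := congrArg (fun f => GVec.Hom.hom f (tmul (tmul v w) (δ ω d))) (bimodProj_actRight M N)
  Eq.trans h (hom_eq_smul (bimodProj M N) (hom_eq_smul (M.X ◁ N.actRight)
    (associator_tmul hv hw (δ_mem d))))

lemma whiskerRight_tmulOver (f : M ⟶ M') (v : M.X.carrier) (w : N.X.carrier) :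
    (f ▷ N).hom.hom (tmulOver v w) = tmulOver (f.hom.hom v) w :=
  congrArg (fun f => GVec.Hom.hom f (tmul v w)) (bimodProj_whiskerRight f N)

lemma whiskerLeft_tmulOver (f : N ⟶ N') (v : M.X.carrier) (w : N.X.carrier) :
    (M ◁ f).hom.hom (tmulOver v w) = tmulOver v (f.hom.hom w) :=
  congrArg (fun f => GVec.Hom.hom f (tmul v w)) (bimodProj_whiskerLeft M f)

lemma leftUnitor_tmulOver (d : K) (w : N.X.carrier) :
    (λ_ N).hom.hom.hom (tmulOver (unitBasis β d) w) = lact N d w :=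
  congrArg (fun f => GVec.Hom.hom f (tmul (δ ω d) w)) (bimodProj_leftUnitor N)

lemma rightUnitor_tmulOver (d : K) (w : N.X.carrier) :
    (ρ_ N).hom.hom.hom (tmulOver w (unitBasis β d)) = ract N d w :=
  congrArg (fun f => GVec.Hom.hom f (tmul w (δ ω d))) (bimodProj_rightUnitor N)

lemma associator_tmulOver {x y z : G} {u : M.X.carrier} {v : N.X.carrier} {w : P.X.carrier}
    (hu : u ∈ M.X.component x) (hv : v ∈ N.X.component y) (hw : w ∈ P.X.component z) :
    (α_ M N P).hom.hom.hom (tmulOver (tmulOver u v) w) =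
      (((ω x y z)⁻¹ : kˣ) : k) • tmulOver u (tmulOver v w) :=
  have h := congrArg (fun f => GVec.Hom.hom f (tmul (tmul u v) w)) (bimodProj_associator M N P)
  Eq.trans h (hom_eq_smul (bimodProj M (N ⊗ P)) (hom_eq_smul (M.X ◁ bimodProj N P)
    (associator_tmul hu hv hw)))

lemma iso_inv_apply {M N : GTFusionCat β} (e : M ≅ N) (v : M.X.carrier) :
    e.inv.hom.hom (e.hom.hom.hom v) = v :=
  congrArg (fun f => GVec.Hom.hom (Bimod.Hom.hom f) v) e.hom_inv_id

lemma associator_inv_tmulOver {x y z : G} {u : M.X.carrier} {v : N.X.carrier} {w : P.X.carrier}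
    (hu : u ∈ M.X.component x) (hv : v ∈ N.X.component y) (hw : w ∈ P.X.component z) :
    (α_ M N P).inv.hom.hom (tmulOver u (tmulOver v w)) =
      (ω x y z : k) • tmulOver (tmulOver u v) w := by
  have h := congrArg (α_ M N P).inv.hom.hom (associator_tmulOver hu hv hw)
  rw [iso_inv_apply, map_smul] at h
  rw [h, smul_smul, ← Units.val_mul, mul_inv_cancel, Units.val_one, one_smul]

/-- The morphism `M ⊗_{A(K,β)} N ⟶ P` induced by a degree-preserving map on `M ⊗ N` that is
balanced and commutes with the actions on homogeneous basis vectors. -/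
noncomputable def bimodDescMk {I J : Type*} (b : Module.Basis I k M.X.carrier)
    (c : Module.Basis J k N.X.carrier) {deg : I → G} {deg' : J → G}
    (hv : ∀ i, b i ∈ M.X.component (deg i)) (hw : ∀ j, c j ∈ N.X.component (deg' j))
    (f : M.X ⊗ N.X ⟶ P.X)
    (hb : ∀ (d : K) i j, f.hom (tmul (ract M d (b i)) (c j)) =
      (((ω (deg i) d (deg' j))⁻¹ : kˣ) : k) • f.hom (tmul (b i) (lact N d (c j))))
    (hl : ∀ (d : K) i j, lact P d (f.hom (tmul (b i) (c j))) =
      (ω d (deg i) (deg' j) : k) • f.hom (tmul (lact M d (b i)) (c j)))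
    (hr : ∀ (d : K) i j, ract P d (f.hom (tmul (b i) (c j))) =
      (((ω (deg i) (deg' j) d)⁻¹ : kˣ) : k) • f.hom (tmul (b i) (ract N d (c j)))) :
    M ⊗ N ⟶ P :=
  bimodDesc f
    (GVec.hom_ext <| TensorProduct.ext <| TensorProduct.ext <| b.ext fun i =>
      groupObj_ext fun d => c.ext fun j => (hb d i j).trans
        (hom_eq_smul f (hom_eq_smul (M.X ◁ N.actLeft)
          (associator_tmul (hv i) (δ_mem d) (hw j)))).symm)
    (GVec.hom_ext <| TensorProduct.ext <| groupObj_ext fun d => TensorProduct.ext <| b.ext fun i =>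
      c.ext fun j => (hom_eq_smul f (hom_eq_smul (M.actLeft ▷ N.X)
          (associator_inv_tmul (δ_mem d) (hv i) (hw j)))).trans (hl d i j).symm)
    (GVec.hom_ext <| TensorProduct.ext <| TensorProduct.ext <| b.ext fun i => c.ext fun j =>
      groupObj_ext fun d => (hom_eq_smul f (hom_eq_smul (M.X ◁ N.actRight)
          (associator_tmul (hv i) (hw j) (δ_mem d)))).trans (hr d i j).symm)

lemma bimodDescMk_tmulOver {I J : Type*} (b : Module.Basis I k M.X.carrier)
    (c : Module.Basis J k N.X.carrier) {deg : I → G} {deg' : J → G}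
    (hv : ∀ i, b i ∈ M.X.component (deg i)) (hw : ∀ j, c j ∈ N.X.component (deg' j))
    (f : M.X ⊗ N.X ⟶ P.X)
    (hb : ∀ (d : K) i j, f.hom (tmul (ract M d (b i)) (c j)) =
      (((ω (deg i) d (deg' j))⁻¹ : kˣ) : k) • f.hom (tmul (b i) (lact N d (c j))))
    (hl : ∀ (d : K) i j, lact P d (f.hom (tmul (b i) (c j))) =
      (ω d (deg i) (deg' j) : k) • f.hom (tmul (lact M d (b i)) (c j)))
    (hr : ∀ (d : K) i j, ract P d (f.hom (tmul (b i) (c j))) =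
      (((ω (deg i) (deg' j) d)⁻¹ : kˣ) : k) • f.hom (tmul (b i) (ract N d (c j))))
    (v : M.X.carrier) (w : N.X.carrier) :
    (bimodDescMk b c hv hw f hb hl hr).hom.hom (tmulOver v w) = f.hom (tmul v w) :=
  congrArg (fun f => GVec.Hom.hom f (tmul v w)) (bimodProj_desc f _ _ _)

end TensorOver

/-! ### Generators of tensor products of bimodules -/

section Generation

/-- A family of elements generates a bimodule if their translates under both actions span it. -/
def BiGenerates (N : GTFusionCat β) {I : Type*} (n : I → N.X.carrier) : Prop :=
  Submodule.span k (Set.range fun p : K × I × K => ract N p.2.2 (lact N p.1 (n p.2.1))) = ⊤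

lemma BiGenerates.hom_ext {N P : GTFusionCat β} {I : Type*} {n : I → N.X.carrier}
    (hn : BiGenerates N n) {f g : N ⟶ P} (h : ∀ i, f.hom.hom (n i) = g.hom.hom (n i)) : f = g := by
  refine Bimod.hom_ext _ _ <| GVec.hom_ext <| LinearMap.ext_on_range hn fun p => ?_
  rw [hom_ract, hom_lact, h, hom_ract, hom_lact]

/-- In `(f m c) ⊗ (f' n l)` with `c, f, f', l ∈ K`, the outer actions of `f` and `l` leave the
tensor product and `c` crosses it to join `f'`. Up to invertible scalars what remains is a translate
of `m ⊗ (c f') n`, so one index in `K` suffices between the two generators. -/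
lemma BiGenerates.tensor {M N : GTFusionCat β} {I J : Type*} {m : I → M.X.carrier}
    {n : J → N.X.carrier} (hm : BiGenerates M m) (hn : BiGenerates N n) {deg : I → G}
    {deg' : J → G} (hv : ∀ i, m i ∈ M.X.component (deg i))
    (hw : ∀ j, n j ∈ N.X.component (deg' j)) :
    BiGenerates (M ⊗ N) fun p : I × K × J => tmulOver (m p.1) (lact N p.2.1 (n p.2.2)) := by
  unfold BiGenerates
  set S := Submodule.span k (Set.range fun p : K × (I × K × J) × K =>
    ract (M ⊗ N) p.2.2 (lact (M ⊗ N) p.1 (tmulOver (m p.2.1.1) (lact N p.2.1.2.1 (n p.2.1.2.2)))))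
    with hS
  have key : ∀ f k' f' l i j,
      tmulOver (ract M k' (lact M f (m i))) (ract N l (lact N f' (n j))) ∈ S := by
    intro f c f' l i j
    have h₁ := hv i
    have h₂ := lact_mem h₁ f
    have h₃ := lact_mem (hw j) f'
    have h₄ := lact_mem (hw j) (c * f')
    have e₁ := smul_eq_iff.1 (ract_tmulOver (ract_mem h₂ c) h₃ l).symm
    have e₂ := tmulOver_ract h₂ h₃ c
    have e₃ := smul_eq_iff.2 (lact_tmulOver h₁ h₄ f)
    rw [e₁, e₂, lact_lact (hw j), tmulOver_smul, ← e₃]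
    simp only [map_smul]
    exact S.smul_mem _ <| S.smul_mem _ <| S.smul_mem _ <| S.smul_mem _ <|
      Submodule.subset_span ⟨(f, (i, c * f', j), l), rfl⟩
  -- Linearity in both arguments extends `key` to all tensors: the quotient map by `S` vanishes as a
  -- bilinear map, since it does on spanning families of `M` and `N`.
  have : S.mkQ = 0 := by
    refine tmulOver_ext fun v w => ?_
    have h : (tmulOverₗ M N).compr₂ S.mkQ = 0 := by
      refine LinearMap.ext_on_range hm fun p => LinearMap.ext_on_range hn fun q => ?_
      exact (Submodule.Quotient.mk_eq_zero S).2 (key _ _ _ _ _ _)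
    exact congrArg (fun f => f v w) h
  rw [← S.ker_mkQ, this, LinearMap.ker_zero]

end Generation

end GradedBimodules

/-! ### Cocycle identities and the basis of the Hecke object -/

section HeckeObject

open scoped Classical

open GVec

variable {k G : Type u} [Field k] [Group G]

/-- The contribution of the 3-cocycle to the structure constants of the twisted Hecke algebra. -/
def heckeCocycle (ω : ThreeCocycle k G) (f g h f' g' h' : G) : kˣ :=
  ω (f * g * h) (f' * g') h' * (ω (f * g) h (f' * g'))⁻¹ * ω h f' g' * (ω f g g')⁻¹

/-- Needed for left linearity of the multiplication. The fourth argument is `h⁻¹` because other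
products vanish. Three cocycle equations with first entry `d` suffice; in `Additive kˣ` the claim is
a signed sum of them. -/
lemma heckeCocycle_left (ω : ThreeCocycle k G) (d f g h g' h' : G) :
    heckeCocycle ω (d * f) g h h⁻¹ g' h' * ω d (f * g * h) (h⁻¹ * g' * h') *
        (ω d (f * g) h * ω d f g) =
      heckeCocycle ω f g h h⁻¹ g' h' * (ω d (f * (g * g')) h' * ω d f (g * g')) := by
  have c₁ := congrArg Additive.ofMul (ω.cocycle d (f * g * h) (h⁻¹ * g') h')
  have c₂ := congrArg Additive.ofMul (ω.cocycle d (f * g) h (h⁻¹ * g'))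
  have c₃ := congrArg Additive.ofMul (ω.cocycle d f g g')
  apply Additive.ofMul.injective
  unfold heckeCocycle
  simp only [mul_assoc, mul_inv_cancel_left, ofMul_mul, ofMul_inv] at c₁ c₂ c₃ ⊢
  linear_combination (norm := abel) c₁ - c₂ - c₃

lemma heckeCocycle_right (ω : ThreeCocycle k G) (d f g h g' h' : G) :
    heckeCocycle ω f g h h⁻¹ g' (h' * d) * (ω (f * g * h) (h⁻¹ * g' * h') d)⁻¹ *
        (ω (h⁻¹ * g') h' d)⁻¹ =
      heckeCocycle ω f g h h⁻¹ g' h' * (ω (f * (g * g')) h' d)⁻¹ := by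
  have c₁ := congrArg Additive.ofMul (ω.cocycle (f * g * h) (h⁻¹ * g') h' d)
  apply Additive.ofMul.injective
  unfold heckeCocycle
  simp only [mul_assoc, mul_inv_cancel_left, ofMul_mul, ofMul_inv] at c₁ ⊢
  linear_combination (norm := abel) c₁

/-- Needed for the multiplication to descend to `⊗_{A(K,β)}`. The three cocycle equations leave over
the factor `ω h d f'`, which is later absorbed by the coboundary equation for `β`. -/
lemma heckeCocycle_balanced (ω : ThreeCocycle k G) (d f g h f' g' h' : G) :
    heckeCocycle ω f g (h * d) f' g' h' * (ω (f * g) h d)⁻¹ =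
      heckeCocycle ω f g h (d * f') g' h' * (ω (f * g * h) d (f' * g' * h'))⁻¹ *
        (ω d (f' * g') h' * ω d f' g') * ω h d f' := by
  have c₁ := congrArg Additive.ofMul (ω.cocycle (f * g * h) d (f' * g') h')
  have c₂ := congrArg Additive.ofMul (ω.cocycle (f * g) h d (f' * g'))
  have c₃ := congrArg Additive.ofMul (ω.cocycle h d f' g')
  apply Additive.ofMul.injective
  unfold heckeCocycle
  simp only [mul_assoc, ofMul_mul, ofMul_inv] at c₁ c₂ c₃ ⊢
  linear_combination (norm := abel) c₁ + c₂ + c₃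

variable [Fintype G] {ω : ThreeCocycle k G} {K L : Subgroup G}

/-- The basis `δ_g` of `⨁ g ∈ L, δ_g`. -/
noncomputable def groupBasis (ω : ThreeCocycle k G) (L : Subgroup G) :
    Module.Basis L k (groupObj ω L).carrier :=
  (Finsupp.basisSingleOne : Module.Basis L k (L →₀ k))

lemma groupBasis_apply (g : L) : groupBasis ω L g = δ ω g := by
  change (Finsupp.basisSingleOne : Module.Basis L k (L →₀ k)) g = Finsupp.single g 1
  rw [Finsupp.coe_basisSingleOne]

variable (β : TwoCochain ω K) (ψ : TwoCochain ω L)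

/-- The basis `b(f, g, h)` of the twisted Hecke algebra. -/
noncomputable def heckeBas : Module.Basis ((K × L) × K) k (twistedHecke β ψ).X.carrier :=
  tensorBasis (V := tensor (groupObj ω K) (groupObj ω L)) (W := groupObj ω K)
    (tensorBasis (groupBasis ω K) (groupBasis ω L)) (groupBasis ω K)

lemma heckeBas_apply (p : (K × L) × K) :
    heckeBas β ψ p = heckeBasis β ψ p.1.1 p.1.2 p.2 := by
  refine (tensorBasis_apply (V := tensor (groupObj ω K) (groupObj ω L)) (W := groupObj ω K)
    _ _ p).trans ?_
  rw [tensorBasis_apply, groupBasis_apply, groupBasis_apply, groupBasis_apply]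
  rfl

lemma heckeBasis_mem (f h : K) (g : L) :
    heckeBasis β ψ f g h ∈ (twistedHecke β ψ).X.component (f * g * h) :=
  tmul_mem (tmul_mem (δ_mem f) (δ_mem g)) (δ_mem h)

/-- Two inverse associators bring `δ_d` next to `δ_f`, first past the outer bracket and then past
the inner one; each contributes a value of `ω`. The right action needs a single associator. -/
lemma lact_heckeBasis (d f h : K) (g : L) :
    lact (twistedHecke β ψ) d (heckeBasis β ψ f g h) =
      ((ω d (f * g) h * ω d f g * β d f : kˣ) : k) • heckeBasis β ψ (d * f) g h := by
  have h₁ : (α_ (groupObj ω K) (groupObj ω K ⊗ groupObj ω L) (groupObj ω K)).inv.hom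
      (tmul (δ ω d) (heckeBasis β ψ f g h)) = (ω d (f * g) h : k) •
        tmul (tmul (δ ω d) (tmul (δ ω f) (δ ω g))) (δ ω h) :=
    associator_inv_tmul (δ_mem d) (tmul_mem (δ_mem f) (δ_mem g)) (δ_mem h)
  have h₂ : (α_ (groupObj ω K) (groupObj ω K) (groupObj ω L)).inv.hom
      (tmul (δ ω d) (tmul (δ ω f) (δ ω g))) = (ω d f g : k) •
        tmul (tmul (δ ω d) (δ ω f)) (δ ω g) :=
    associator_inv_tmul (δ_mem d) (δ_mem f) (δ_mem g)
  have h₃ : ((groupAlgMul β ▷ groupObj ω L) ▷ groupObj ω K).hom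
      (((α_ (groupObj ω K) (groupObj ω K) (groupObj ω L)).inv ▷ groupObj ω K).hom
        (tmul (tmul (δ ω d) (tmul (δ ω f) (δ ω g))) (δ ω h))) =
      ((ω d f g : k) * (β d f : k)) • heckeBasis β ψ (d * f) g h := by
    rw [whiskerRight_tmul, h₂, map_smul, LinearMap.smul_apply, map_smul, whiskerRight_tmul,
      whiskerRight_tmul, groupAlgMul_δ, map_smul, LinearMap.smul_apply, map_smul,
      LinearMap.smul_apply, smul_smul]
    rfl
  have h₄ : lact (twistedHecke β ψ) d (heckeBasis β ψ f g h) =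
      (ω d (f * g) h : k) • ((ω d f g : k) * (β d f : k)) • heckeBasis β ψ (d * f) g h :=
    Eq.trans (hom_eq_smul ((groupAlgMul β ▷ groupObj ω L) ▷ groupObj ω K) (hom_eq_smul
      ((α_ (groupObj ω K) (groupObj ω K) (groupObj ω L)).inv ▷ groupObj ω K) h₁))
      (congrArg ((ω d (f * g) h : k) • ·) h₃)
  rw [h₄, smul_smul, Units.val_mul, Units.val_mul, mul_assoc]

lemma ract_heckeBasis (d f h : K) (g : L) :
    ract (twistedHecke β ψ) d (heckeBasis β ψ f g h) =
      (((ω (f * g) h d)⁻¹ * β h d : kˣ) : k) • heckeBasis β ψ f g (h * d) := by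
  have h₁ : (α_ (groupObj ω K ⊗ groupObj ω L) (groupObj ω K) (groupObj ω K)).hom.hom
      (tmul (heckeBasis β ψ f g h) (δ ω d)) = (((ω (f * g) h d)⁻¹ : kˣ) : k) •
        tmul (tmul (δ ω f) (δ ω g)) (tmul (δ ω h) (δ ω d)) :=
    associator_tmul (tmul_mem (δ_mem f) (δ_mem g)) (δ_mem h) (δ_mem d)
  refine Eq.trans (hom_eq_smul ((groupObj ω K ⊗ groupObj ω L) ◁ groupAlgMul β) h₁) ?_
  rw [whiskerLeft_tmul, groupAlgMul_δ, map_smul, smul_smul, Units.val_mul]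
  rfl

/-- No scalar appears, because `ω` and `β` are normalized and the outer indices of the generator are
`1`. -/
lemma heckeBasis_eq (f h : K) (g : L) :
    heckeBasis β ψ f g h =
      ract (twistedHecke β ψ) h (lact (twistedHecke β ψ) f (heckeBasis β ψ 1 g 1)) := by
  rw [lact_heckeBasis, map_smul, ract_heckeBasis, mul_one, one_mul]
  simp [ω.one_middle, ω.one_right, β.one_left, β.one_right]

lemma biGenerates_heckeBasis :
    BiGenerates (twistedHecke β ψ) fun g : L => heckeBasis β ψ 1 g 1 := by
  rw [BiGenerates, eq_top_iff, ← (heckeBas β ψ).span_eq, Submodule.span_le]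
  rintro _ ⟨p, rfl⟩
  rw [heckeBas_apply, heckeBasis_eq]
  exact Submodule.subset_span ⟨(p.1.1, p.1.2, p.2), rfl⟩

end HeckeObject

/-! ### Freeness of the Hecke object and its multiplication -/

section HeckeMaps

open scoped Classical

open GVec

variable {k G : Type u} [Field k] [Group G] [Fintype G] {ω : ThreeCocycle k G} {K L : Subgroup G}

/-- A morphism of bimodules, from its values on a homogeneous basis. -/
noncomputable def bimodHomOfBasis {β : TwoCochain ω K} {M N : GTFusionCat β} {I : Type*}
    (b : Module.Basis I k M.X.carrier) (deg : I → G) (hb : ∀ i, b i ∈ M.X.component (deg i))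
    (f : I → N.X.carrier) (hf : ∀ i, f i ∈ N.X.component (deg i))
    (hl : ∀ d i, (homOfBasis b deg hb f hf).hom (lact M d (b i)) = lact N d (f i))
    (hr : ∀ d i, (homOfBasis b deg hb f hf).hom (ract M d (b i)) = ract N d (f i)) : M ⟶ N :=
  bimodHomMk (homOfBasis b deg hb f hf)
    (fun d => LinearMap.congr_fun (f := (homOfBasis b deg hb f hf).hom ∘ₗ lact M d)
      (g := lact N d ∘ₗ (homOfBasis b deg hb f hf).hom) (b.ext fun i => by
        rw [LinearMap.comp_apply, LinearMap.comp_apply, hl, homOfBasis_apply]))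
    (fun d => LinearMap.congr_fun (f := (homOfBasis b deg hb f hf).hom ∘ₗ ract M d)
      (g := ract N d ∘ₗ (homOfBasis b deg hb f hf).hom) (b.ext fun i => by
        rw [LinearMap.comp_apply, LinearMap.comp_apply, hr, homOfBasis_apply]))

lemma bimodHomOfBasis_apply {β : TwoCochain ω K} {M N : GTFusionCat β} {I : Type*}
    (b : Module.Basis I k M.X.carrier) (deg : I → G) (hb : ∀ i, b i ∈ M.X.component (deg i))
    (f : I → N.X.carrier) (hf : ∀ i, f i ∈ N.X.component (deg i))
    (hl : ∀ d i, (homOfBasis b deg hb f hf).hom (lact M d (b i)) = lact N d (f i))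
    (hr : ∀ d i, (homOfBasis b deg hb f hf).hom (ract M d (b i)) = ract N d (f i)) (i : I) :
    (bimodHomOfBasis b deg hb f hf hl hr).hom.hom (b i) = f i :=
  homOfBasis_apply b deg hb f hf i

variable (β : TwoCochain ω K) (ψ : TwoCochain ω L)

lemma lact_unitBasis (c d : K) :
    lact (𝟙_ (GTFusionCat β)) c (unitBasis β d) = (β c d : k) • unitBasis β (c * d) :=
  groupAlgMul_δ β c d

lemma ract_unitBasis (c d : K) :
    ract (𝟙_ (GTFusionCat β)) d (unitBasis β c) = (β c d : k) • unitBasis β (c * d) :=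
  groupAlgMul_δ β c d

lemma unitBasis_mem (d : K) : unitBasis β d ∈ (𝟙_ (GTFusionCat β)).X.component d :=
  δ_mem d

/-- The basis `δ_d` of the unit object. -/
noncomputable def unitBas : Module.Basis K k (𝟙_ (GTFusionCat β)).X.carrier :=
  groupBasis ω K

lemma unitBas_apply (d : K) : unitBas β d = unitBasis β d :=
  groupBasis_apply d

lemma biGenerates_unitBasis :
    BiGenerates (𝟙_ (GTFusionCat β)) fun _ : Unit => unitBasis β 1 := by
  have h : Submodule.span k (Set.range (unitBasis β)) = ⊤ := by
    rw [← (unitBas β).span_eq, show ⇑(unitBas β) = unitBasis β from funext (unitBas_apply β)]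
  rw [BiGenerates, eq_top_iff, ← h, Submodule.span_le]
  rintro _ ⟨d, rfl⟩
  refine Submodule.subset_span ⟨(d, (), 1), ?_⟩
  change ract _ 1 (lact _ d (unitBasis β 1)) = _
  rw [ract_one, lact_unitBasis, β.one_right, Units.val_one, one_smul, mul_one]

/-- The morphism from the twisted Hecke algebra with prescribed values on the generators
`b(1, g, 1)`. -/
noncomputable def heckeLift {N : GTFusionCat β} (x : L → N.X.carrier)
    (hx : ∀ g : L, x g ∈ N.X.component g) : twistedHecke β ψ ⟶ N :=
  bimodHomOfBasis (heckeBas β ψ) (fun p => p.1.1 * p.1.2 * p.2)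
    (fun p => by
      rw [heckeBas_apply]
      exact heckeBasis_mem β ψ _ _ _)
    (fun p => ract N p.2 (lact N p.1.1 (x p.1.2)))
    (fun p => ract_mem (lact_mem (hx p.1.2) p.1.1) p.2)
    -- Moving `d` past the right action and merging it with the first index costs `ω(d,fg,h)`,
    -- `ω(d,f,g)` and `β(d,f)` in every bimodule. These are exactly the scalars of
    -- `lact_heckeBasis`, so no condition on `x` other than its degree is required.
    (fun d p => by
      rw [heckeBas_apply, lact_heckeBasis, map_smul,
        ← heckeBas_apply β ψ ((d * p.1.1, p.1.2), p.2), homOfBasis_apply,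
        lact_ract (lact_mem (hx p.1.2) p.1.1), lact_lact (hx p.1.2), map_smul, smul_smul,
        ← Units.val_mul, mul_assoc])
    (fun d p => by
      rw [heckeBas_apply, ract_heckeBasis, map_smul,
        ← heckeBas_apply β ψ ((p.1.1, p.1.2), p.2 * d), homOfBasis_apply,
        ract_ract (lact_mem (hx p.1.2) p.1.1)])

lemma heckeLift_apply {N : GTFusionCat β} (x : L → N.X.carrier)
    (hx : ∀ g : L, x g ∈ N.X.component g) (f h : K) (g : L) :
    (heckeLift β ψ x hx).hom.hom (heckeBasis β ψ f g h) = ract N h (lact N f (x g)) := by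
  rw [← heckeBas_apply β ψ ((f, g), h)]
  exact bimodHomOfBasis_apply _ _ _ _ _ _ _ _

lemma heckeLift_gen {N : GTFusionCat β} (x : L → N.X.carrier)
    (hx : ∀ g : L, x g ∈ N.X.component g) (g : L) :
    (heckeLift β ψ x hx).hom.hom (heckeBasis β ψ 1 g 1) = x g := by
  rw [heckeLift_apply, lact_one, ract_one]

/-- The structure constants of the multiplication of the twisted Hecke algebra. -/
def heckeCoeff (f : K) (g : L) (h f' : K) (g' : L) (h' : K) : kˣ :=
  heckeCocycle ω f g h f' g' h' * β h f' * ψ g g'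

/-- The product of two basis vectors of the twisted Hecke algebra. -/
noncomputable def heckeProd (p q : (K × L) × K) : (twistedHecke β ψ).X.carrier :=
  if p.2 * q.1.1 = 1 then
    (heckeCoeff β ψ p.1.1 p.1.2 p.2 q.1.1 q.1.2 q.2 : k) •
      heckeBasis β ψ p.1.1 (p.1.2 * q.1.2) q.2
  else 0

/-- When `h f' = 1` the inner part of `(f g h)(f' g' h')` cancels and leaves `f (g g') h'`. -/
lemma heckeProd_mem (p q : (K × L) × K) :
    heckeProd β ψ p q ∈ (twistedHecke β ψ).X.component
      ((p.1.1 * p.1.2 * p.2 : G) * (q.1.1 * q.1.2 * q.2)) := by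
  unfold heckeProd
  split_ifs with h
  · refine Submodule.smul_mem _ _ ?_
    have h' : (p.2 : G) * q.1.1 = 1 := congrArg Subtype.val h
    have e : (p.1.1 * p.1.2 * p.2 : G) * (q.1.1 * q.1.2 * q.2) =
        p.1.1 * (p.1.2 * q.1.2 : L) * q.2 := by
      rw [Subgroup.coe_mul]
      simp only [mul_assoc]
      rw [← mul_assoc (p.2 : G), h', one_mul]
    rw [e]
    exact heckeBasis_mem β ψ _ _ _
  · exact zero_mem _

/-- The multiplication of the twisted Hecke algebra, as a morphism of graded spaces. -/
noncomputable def heckeMulHom :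
    (twistedHecke β ψ).X ⊗ (twistedHecke β ψ).X ⟶ (twistedHecke β ψ).X :=
  homOfBasis₂ (heckeBas β ψ) (heckeBas β ψ) (fun p => p.1.1 * p.1.2 * p.2)
    (fun p => p.1.1 * p.1.2 * p.2)
    (fun p => by
      rw [heckeBas_apply]
      exact heckeBasis_mem β ψ _ _ _)
    (fun p => by
      rw [heckeBas_apply]
      exact heckeBasis_mem β ψ _ _ _)
    (heckeProd β ψ) (heckeProd_mem β ψ)

lemma heckeMulHom_apply (f h f' h' : K) (g g' : L) :
    (heckeMulHom β ψ).hom (tmul (heckeBasis β ψ f g h) (heckeBasis β ψ f' g' h')) =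
      if h * f' = 1 then
        (heckeCoeff β ψ f g h f' g' h' : k) • heckeBasis β ψ f (g * g') h'
      else 0 := by
  rw [← heckeBas_apply β ψ ((f, g), h), ← heckeBas_apply β ψ ((f', g'), h')]
  exact homOfBasis₂_apply _ _ _ _ _ _ _ _ _ _

/-- The multiplication of the twisted Hecke algebra. -/
noncomputable def heckeMul : twistedHecke β ψ ⊗ twistedHecke β ψ ⟶ twistedHecke β ψ :=
  bimodDescMk (heckeBas β ψ) (heckeBas β ψ) (deg := fun p => p.1.1 * p.1.2 * p.2)
    (deg' := fun p => p.1.1 * p.1.2 * p.2)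
    (fun p => by
      rw [heckeBas_apply]
      exact heckeBasis_mem β ψ _ _ _)
    (fun p => by
      rw [heckeBas_apply]
      exact heckeBasis_mem β ψ _ _ _)
    (heckeMulHom β ψ)
    (fun d p q => by
      simp only [heckeBas_apply, ract_heckeBasis, lact_heckeBasis, map_smul, LinearMap.smul_apply,
        heckeMulHom_apply, mul_assoc]
      split_ifs with h
      · simp only [smul_smul, ← Units.val_mul]
        congr 2
        have e := congrArg Additive.ofMul (heckeCocycle_balanced ω d p.1.1 p.1.2 p.2 q.1.1 q.1.2 q.2)
        -- The equation for `β` at `(h, d, f')` compensates the factor `ω h d f'` left over by the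
        -- three cocycle equations.
        have e' := congrArg Additive.ofMul (β.coboundary p.2 d q.1.1)
        apply Additive.ofMul.injective
        simp only [heckeCoeff, mul_assoc, ofMul_mul, ofMul_inv, Subgroup.coe_mul] at e e' ⊢
        linear_combination (norm := abel) e - e'
      · simp only [smul_zero])
    (fun d p q => by
      simp only [heckeBas_apply, lact_heckeBasis, map_smul, LinearMap.smul_apply,
        heckeMulHom_apply]
      split_ifs with h
      · rw [map_smul, lact_heckeBasis]
        simp only [smul_smul, ← Units.val_mul]
        congr 2
        have e := congrArg Additive.ofMul (heckeCocycle_left ω d p.1.1 p.1.2 p.2 q.1.2 q.2)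
        -- In the surviving case the first index of the right factor is determined, which puts the
        -- constants in the form of `heckeCocycle_left`.
        have h' : q.1.1 = p.2⁻¹ := (inv_eq_of_mul_eq_one_right h).symm
        apply Additive.ofMul.injective
        rw [h']
        simp only [heckeCoeff, ofMul_mul, Subgroup.coe_mul, Subgroup.coe_inv] at e ⊢
        linear_combination (norm := abel) -e
      · simp only [map_zero, smul_zero])
    (fun d p q => by
      simp only [heckeBas_apply, ract_heckeBasis, map_smul, heckeMulHom_apply]
      split_ifs with h
      · rw [map_smul, ract_heckeBasis]
        simp only [smul_smul, ← Units.val_mul]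
        congr 2
        have e := congrArg Additive.ofMul (heckeCocycle_right ω d p.1.1 p.1.2 p.2 q.1.2 q.2)
        have h' : q.1.1 = p.2⁻¹ := (inv_eq_of_mul_eq_one_right h).symm
        apply Additive.ofMul.injective
        rw [h']
        simp only [heckeCoeff, ofMul_mul, ofMul_inv, Subgroup.coe_mul, Subgroup.coe_inv] at e ⊢
        linear_combination (norm := abel) -e
      · simp only [map_zero, smul_zero])

lemma heckeMul_apply (f h f' h' : K) (g g' : L) :
    (heckeMul β ψ).hom.hom (tmulOver (heckeBasis β ψ f g h) (heckeBasis β ψ f' g' h')) =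
      if h * f' = 1 then
        (heckeCoeff β ψ f g h f' g' h' : k) • heckeBasis β ψ f (g * g') h'
      else 0 :=
  (bimodDescMk_tmulOver _ _ _ _ _ _ _ _ _ _).trans (heckeMulHom_apply β ψ f h f' h' g g')

end HeckeMaps

/-! ### Unit, counit and comultiplication -/

section HeckeStructure

open scoped Classical

open GVec

variable {k G : Type u} [Field k] [Group G] [Fintype G] {ω : ThreeCocycle k G} {K L : Subgroup G}
  (β : TwoCochain ω K) (ψ : TwoCochain ω L)

/-- The unit of the twisted Hecke algebra. -/
noncomputable def heckeUnit : 𝟙_ (GTFusionCat β) ⟶ twistedHecke β ψ :=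
  bimodHomOfBasis (unitBas β) (fun d => d)
    (fun d => by
      rw [unitBas_apply]
      exact unitBasis_mem β d)
    (fun d => ∑ s : K, (((β (d * s⁻¹) s)⁻¹ : kˣ) : k) • heckeBasis β ψ (d * s⁻¹) 1 s)
    (fun d => Submodule.sum_mem _ fun s _ => Submodule.smul_mem _ _ (by
      have h := heckeBasis_mem β ψ (d * s⁻¹) s 1
      rwa [Subgroup.coe_one, mul_one, ← Subgroup.coe_mul, inv_mul_cancel_right] at h))
    (fun c d => by
      rw [unitBas_apply, lact_unitBasis, map_smul, ← unitBas_apply, homOfBasis_apply, map_sum,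
        Finset.smul_sum]
      refine Finset.sum_congr rfl fun s _ => ?_
      rw [map_smul, lact_heckeBasis, smul_smul, smul_smul, ← Units.val_mul, ← Units.val_mul,
        mul_assoc c]
      congr 2
      have e := congrArg Additive.ofMul (β.coboundary c (d * s⁻¹) s)
      apply Additive.ofMul.injective
      simp only [mul_assoc, inv_mul_cancel, mul_one, ofMul_mul, ofMul_inv, ω.one_right,
        Subgroup.coe_mul, Subgroup.coe_one] at e ⊢
      linear_combination (norm := abel) e)
    (fun c d => by
      -- The right action of `δ_c` moves the third index from `s` to `s c`, so the sum for `δ_{dc}`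
      -- is reindexed by right translation. The left action keeps `s` and needs no reindexing.
      rw [unitBas_apply, ract_unitBasis, map_smul, ← unitBas_apply, homOfBasis_apply, map_sum,
        Finset.smul_sum, ← Equiv.sum_comp (Equiv.mulRight c)]
      refine Finset.sum_congr rfl fun s _ => ?_
      rw [map_smul, ract_heckeBasis, smul_smul, smul_smul, ← Units.val_mul, ← Units.val_mul,
        Equiv.coe_mulRight, mul_inv_rev, mul_assoc d, mul_inv_cancel_left]
      congr 2
      have e := congrArg Additive.ofMul (β.coboundary (d * s⁻¹) s c)
      apply Additive.ofMul.injective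
      simp only [mul_assoc, inv_mul_cancel, mul_one, ofMul_mul, ofMul_inv,
        Subgroup.coe_mul, Subgroup.coe_one] at e ⊢
      linear_combination (norm := abel) -e)

lemma heckeUnit_apply (d : K) :
    (heckeUnit β ψ).hom.hom (unitBasis β d) =
      ∑ s : K, (((β (d * s⁻¹) s)⁻¹ : kˣ) : k) • heckeBasis β ψ (d * s⁻¹) 1 s := by
  rw [← unitBas_apply]
  exact bimodHomOfBasis_apply _ _ _ _ _ _ _ _

/-- The counit of the twisted Hecke algebra. -/
noncomputable def heckeCounit : twistedHecke β ψ ⟶ 𝟙_ (GTFusionCat β) :=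
  heckeLift β ψ (fun g => if g = 1 then (Nat.card L : k) • unitBasis β 1 else 0) fun g => by
    split_ifs with h
    · rw [h]
      exact Submodule.smul_mem _ _ (unitBasis_mem β 1)
    · exact zero_mem _

lemma heckeCounit_apply (f h : K) (g : L) :
    (heckeCounit β ψ).hom.hom (heckeBasis β ψ f g h) =
      if g = 1 then ((Nat.card L : k) * (β f h : k)) • unitBasis β (f * h) else 0 := by
  rw [heckeCounit, heckeLift_apply]
  split_ifs with hg
  · rw [map_smul, map_smul, lact_unitBasis, map_smul, mul_one, ract_unitBasis, β.one_right,
      Units.val_one, one_smul, smul_smul]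
  · rw [map_zero, map_zero]

/-- The structure constants of the comultiplication of the twisted Hecke algebra on the generators
`b(1, g, 1)`. -/
def heckeCoCoeff (g t : L) (s : K) : kˣ :=
  ω (g * t) s ((s : G)⁻¹ * (t : G)⁻¹) * (ω s (s : G)⁻¹ (t : G)⁻¹)⁻¹ * (ψ (g * t) t⁻¹)⁻¹ *
    (β s s⁻¹)⁻¹

/-- The value of the comultiplication of the twisted Hecke algebra on `b(1, g, 1)`. -/
noncomputable def heckeCoprod (g : L) : (twistedHecke β ψ ⊗ twistedHecke β ψ).X.carrier :=
  ((Nat.card K : k)⁻¹ * (Nat.card L : k)⁻¹) • ∑ t : L, ∑ s : K,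
    (heckeCoCoeff β ψ g t s : k) •
      tmulOver (heckeBasis β ψ 1 (g * t) s) (heckeBasis β ψ s⁻¹ t⁻¹ 1)

lemma heckeCoprod_mem (g : L) :
    heckeCoprod β ψ g ∈ (twistedHecke β ψ ⊗ twistedHecke β ψ).X.component g :=
  Submodule.smul_mem _ _ <| Submodule.sum_mem _ fun t _ => Submodule.sum_mem _ fun s _ =>
    Submodule.smul_mem _ _ (by
      have h := tmulOver_mem (heckeBasis_mem β ψ 1 s (g * t)) (heckeBasis_mem β ψ s⁻¹ 1 t⁻¹)
      simpa [mul_assoc] using h)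

/-- The comultiplication of the twisted Hecke algebra. -/
noncomputable def heckeComul : twistedHecke β ψ ⟶ twistedHecke β ψ ⊗ twistedHecke β ψ :=
  heckeLift β ψ (heckeCoprod β ψ) (heckeCoprod_mem β ψ)

/-- Passes from the values of the comultiplication on the generators to those on all basis vectors.
Two scalars come from moving `f` into the first factor and one from moving `h` into the second; the
others are trivial by normalization. -/
lemma act_tmulOver_heckeBasis (f s s' h : K) (x y : L) :
    ract (twistedHecke β ψ ⊗ twistedHecke β ψ) h (lact (twistedHecke β ψ ⊗ twistedHecke β ψ) f
      (tmulOver (heckeBasis β ψ 1 x s) (heckeBasis β ψ s' y 1))) =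
      ((ω f (x * s) (s' * y) * ω f x s * (ω (f * x * s) (s' * y) h)⁻¹ : kˣ) : k) •
        tmulOver (heckeBasis β ψ f x s) (heckeBasis β ψ s' y h) := by
  rw [lact_tmulOver (heckeBasis_mem β ψ _ _ _) (heckeBasis_mem β ψ _ _ _), lact_heckeBasis,
    smul_tmulOver, map_smul, map_smul, ract_tmulOver (heckeBasis_mem β ψ _ _ _)
    (heckeBasis_mem β ψ _ _ _), ract_heckeBasis, tmulOver_smul, smul_smul, smul_smul, smul_smul,
    ← Units.val_mul, ← Units.val_mul, ← Units.val_mul]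
  simp only [mul_one, one_mul, Subgroup.coe_one, ω.one_middle, β.one_left, β.one_right, inv_one]

/-- Translating the value at `b(1,g,1)` gives the stated coefficients up to one cocycle equation, at
`(f, gt, s, s⁻¹t⁻¹)`. -/
lemma heckeComul_apply (f h : K) (g : L) :
    (heckeComul β ψ).hom.hom (heckeBasis β ψ f g h) =
      ((Nat.card K : k)⁻¹ * (Nat.card L : k)⁻¹) • ∑ t : L, ∑ s : K,
        ((ω f (g * t) (t : G)⁻¹ * ω (f * g * t) s ((s : G)⁻¹ * (t : G)⁻¹) *
          (ω (f * g * t * s) ((s : G)⁻¹ * (t : G)⁻¹) h)⁻¹ * (ω s (s : G)⁻¹ (t : G)⁻¹)⁻¹ *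
          (ψ (g * t) t⁻¹)⁻¹ * (β s s⁻¹)⁻¹ : kˣ) : k) •
            tmulOver (heckeBasis β ψ f (g * t) s) (heckeBasis β ψ s⁻¹ t⁻¹ h) := by
  rw [heckeComul, heckeLift_apply, heckeCoprod]
  simp only [map_smul, map_sum, act_tmulOver_heckeBasis, smul_smul, ← Units.val_mul]
  congr 1
  refine Finset.sum_congr rfl fun t _ => Finset.sum_congr rfl fun s _ => ?_
  congr 2
  have e := congrArg Additive.ofMul (ω.cocycle f (g * t) s ((s : G)⁻¹ * (t : G)⁻¹))
  apply Additive.ofMul.injective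
  simp only [heckeCoCoeff, Subgroup.coe_mul, Subgroup.coe_inv, mul_assoc, mul_inv_cancel_left,
    ofMul_mul, ofMul_inv] at e ⊢
  linear_combination (norm := abel) -e

end HeckeStructure

/-! ### Algebra, coalgebra and Frobenius axioms -/

section HeckeFrobenius

open scoped Classical

open GVec

variable {k G : Type u} [Field k] [Group G] [Fintype G] {ω : ThreeCocycle k G} {K L : Subgroup G}

lemma bimod_comp_apply {β : TwoCochain ω K} {M N P : GTFusionCat β} (f : M ⟶ N) (g : N ⟶ P)
    (v : M.X.carrier) : (f ≫ g).hom.hom v = g.hom.hom (f.hom.hom v) := rfl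

lemma bimod_id_apply {β : TwoCochain ω K} {M : GTFusionCat β} (v : M.X.carrier) :
    (𝟙 M : M ⟶ M).hom.hom v = v := rfl

variable (β : TwoCochain ω K) (ψ : TwoCochain ω L)

lemma leftUnitor_inv_eq_tmulOver (N : GTFusionCat β) (v : N.X.carrier) :
    (λ_ N).inv.hom.hom v = tmulOver (unitBasis β 1) v := by
  rw [← iso_inv_apply (λ_ N) (tmulOver (unitBasis β 1) v), leftUnitor_tmulOver, lact_one]

lemma rightUnitor_inv_eq_tmulOver (N : GTFusionCat β) (v : N.X.carrier) :
    (ρ_ N).inv.hom.hom v = tmulOver v (unitBasis β 1) := by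
  rw [← iso_inv_apply (ρ_ N) (tmulOver v (unitBasis β 1)), rightUnitor_tmulOver, ract_one]

lemma lact_heckeBasis_one (f : K) (g : L) :
    lact (twistedHecke β ψ) f (heckeBasis β ψ 1 g 1) = heckeBasis β ψ f g 1 := by
  rw [lact_heckeBasis]
  simp [ω.one_middle, ω.one_right, β.one_right]

/-- With trivial outer indices on the left factor, most values of `ω` and `β` are trivial. This form
and `heckeMul_gen_right` cover the products needed for associativity and the Frobenius relations on
generators. -/
lemma heckeMul_gen_left (f' h' : K) (g g' : L) :
    (heckeMul β ψ).hom.hom (tmulOver (heckeBasis β ψ 1 g 1) (heckeBasis β ψ f' g' h')) =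
      if f' = 1 then ((ω g g' h' * ψ g g' : kˣ) : k) • heckeBasis β ψ 1 (g * g') h' else 0 := by
  rw [heckeMul_apply]
  simp only [one_mul]
  refine if_ctx_congr Iff.rfl (fun h => ?_) fun _ => rfl
  subst h
  congr 2
  simp [heckeCoeff, heckeCocycle, ω.one_left, ω.one_middle, β.one_left]

lemma heckeMul_gen_right (f f' : K) (g g' : L) :
    (heckeMul β ψ).hom.hom (tmulOver (heckeBasis β ψ f g 1) (heckeBasis β ψ f' g' 1)) =
      if f' = 1 then (((ω f g g')⁻¹ * ψ g g' : kˣ) : k) • heckeBasis β ψ f (g * g') 1 else 0 := by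
  rw [heckeMul_apply]
  simp only [one_mul]
  refine if_ctx_congr Iff.rfl (fun h => ?_) fun _ => rfl
  subst h
  congr 2
  simp [heckeCoeff, heckeCocycle, ω.one_left, ω.one_middle, ω.one_right, β.one_left]

/-- The algebra structure of the twisted Hecke algebra. -/
noncomputable abbrev heckeMonObj : MonObj (twistedHecke β ψ) where
  one := heckeUnit β ψ
  mul := heckeMul β ψ
  one_mul := by
    -- Precomposition with the inverse unitor turns the axiom into an identity of endomorphisms of
    -- `A`, testable on `b(1,g,1)`. There only the summand `s = 1` of the unit has a nonzero product
    -- with the generator.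
    rw [← cancel_epi (λ_ _).inv, Iso.inv_hom_id]
    refine (biGenerates_heckeBasis β ψ).hom_ext fun g => ?_
    rw [bimod_comp_apply, bimod_comp_apply, leftUnitor_inv_eq_tmulOver, whiskerRight_tmulOver,
      heckeUnit_apply, sum_tmulOver, map_sum, Finset.sum_eq_single 1, smul_tmulOver, map_smul,
      inv_one, mul_one, heckeMul_gen_left, if_pos rfl, bimod_id_apply]
    · simp [ω.one_right, β.one_left, ψ.one_left]
    · intro s _ hs
      rw [smul_tmulOver, map_smul, heckeMul_apply, mul_one, if_neg hs, smul_zero]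
    · simp
  mul_one := by
    rw [← cancel_epi (ρ_ _).inv, Iso.inv_hom_id]
    refine (biGenerates_heckeBasis β ψ).hom_ext fun g => ?_
    rw [bimod_comp_apply, bimod_comp_apply, rightUnitor_inv_eq_tmulOver, whiskerLeft_tmulOver,
      heckeUnit_apply, tmulOver_sum, map_sum, Finset.sum_eq_single 1, tmulOver_smul, map_smul,
      inv_one, mul_one, heckeMul_gen_left, if_pos rfl, bimod_id_apply]
    · simp [ω.one_right, β.one_left, ψ.one_right]
    · intro s _ hs
      rw [tmulOver_smul, map_smul, heckeMul_apply, one_mul, one_mul, if_neg (by simpa using hs),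
        smul_zero]
    · simp
  mul_assoc := by
    refine (((biGenerates_heckeBasis β ψ).tensor (biGenerates_heckeBasis β ψ)
      (fun g => heckeBasis_mem β ψ 1 1 g) (fun g => heckeBasis_mem β ψ 1 1 g)).tensor
      (biGenerates_heckeBasis β ψ) (fun p => tmulOver_mem (heckeBasis_mem β ψ 1 1 p.1)
      (lact_mem (heckeBasis_mem β ψ 1 1 p.2.2) p.2.1))
      (fun g => heckeBasis_mem β ψ 1 1 g)).hom_ext ?_
    rintro ⟨⟨g, f, g'⟩, f', g''⟩
    simp only [lact_heckeBasis_one, bimod_comp_apply]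
    rw [associator_tmulOver (heckeBasis_mem β ψ 1 1 g) (heckeBasis_mem β ψ f 1 g')
      (heckeBasis_mem β ψ f' 1 g''), whiskerRight_tmulOver, map_smul, map_smul,
      whiskerLeft_tmulOver, heckeMul_gen_right β ψ 1 f, heckeMul_gen_right β ψ f f']
    -- Both bracketings vanish unless `f = f' = 1`. In that case the associator contributes
    -- `ω(g,g',g'')⁻¹`, and the identity is `dψ = ω` at `(g,g',g'')`.
    split_ifs with h h' h'
    · rw [smul_tmulOver, map_smul, heckeMul_gen_left, if_pos h', tmulOver_smul, map_smul,
        heckeMul_gen_left, if_pos h]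
      subst h h'
      simp only [smul_smul, ← Units.val_mul, mul_assoc]
      congr 2
      have e := congrArg Additive.ofMul (ψ.coboundary g g' g'')
      apply Additive.ofMul.injective
      simp only [Subgroup.coe_one, mul_one, one_mul, ω.one_left, ω.one_right, inv_one,
        ofMul_mul, ofMul_inv] at e ⊢
      linear_combination (norm := abel) -e
    · rw [smul_tmulOver, map_smul, heckeMul_gen_left, if_neg h', tmulOver_zero, map_zero,
        smul_zero, smul_zero]
    · rw [zero_tmulOver, map_zero, tmulOver_smul, map_smul, heckeMul_gen_left, if_neg h,
        smul_zero, smul_zero]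
    · rw [zero_tmulOver, map_zero, tmulOver_zero, map_zero, smul_zero]

lemma heckeComul_gen (g : L) :
    (heckeComul β ψ).hom.hom (heckeBasis β ψ 1 g 1) = heckeCoprod β ψ g :=
  heckeLift_gen β ψ _ (heckeCoprod_mem β ψ) g

lemma units_mul_mul_cancel {u v : kˣ} (c : k) (h : u * v = 1) : (u : k) * (c * (v : k)) = c := by
  rw [mul_left_comm, ← Units.val_mul, h, Units.val_one, mul_one]

lemma natCard_ne_zero [CharZero k] (H : Subgroup G) : (Nat.card H : k) ≠ 0 :=
  Nat.cast_ne_zero.2 Nat.card_pos.ne'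

lemma sum_const_subgroup {V : Type*} [AddCommGroup V] [Module k V] (H : Subgroup G) (v : V) :
    ∑ _s : H, v = (Nat.card H : k) • v := by
  rw [Finset.sum_const, Finset.card_univ, ← Nat.card_eq_fintype_card, ← Nat.cast_smul_eq_nsmul k]

lemma natCard_inv_mul_inv_smul [CharZero k] {V : Type*} [AddCommGroup V] [Module k V]
    (H H' : Subgroup G) (v : V) :
    ((Nat.card H : k)⁻¹ * (Nat.card H' : k)⁻¹) • (Nat.card H : k) • (Nat.card H' : k) • v = v := by
  rw [smul_smul, smul_smul, ← mul_inv, mul_assoc, inv_mul_cancel₀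
    (mul_ne_zero (natCard_ne_zero H) (natCard_ne_zero H')), one_smul]

/-- Multiplying the first leg of the coproduct of `b(1,g',1)` by `b(1,g,1)` changes `g' t` to `g g'
t` and leaves `s`, `t` alone. The two sums therefore agree term by term, by one cocycle equation and
one instance of `dψ = ω`; for `f ≠ 1` both sides are zero. -/
lemma heckeFrobenius_left :
    twistedHecke β ψ ◁ heckeComul β ψ ≫ (α_ _ _ _).inv ≫ heckeMul β ψ ▷ twistedHecke β ψ =
      heckeMul β ψ ≫ heckeComul β ψ := by
  refine ((biGenerates_heckeBasis β ψ).tensor (biGenerates_heckeBasis β ψ)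
    (fun g => heckeBasis_mem β ψ 1 1 g) (fun g => heckeBasis_mem β ψ 1 1 g)).hom_ext ?_
  rintro ⟨g, f, g'⟩
  simp only [lact_heckeBasis_one, bimod_comp_apply]
  rw [whiskerLeft_tmulOver, heckeComul_apply, heckeMul_gen_right, tmulOver_smul, map_smul,
    map_smul]
  simp only [tmulOver_sum, map_sum, tmulOver_smul, map_smul]
  split_ifs with h
  · subst h
    rw [map_smul, heckeComul_gen, heckeCoprod, smul_comm]
    simp only [Finset.smul_sum]
    refine Finset.sum_congr rfl fun t _ => Finset.sum_congr rfl fun s _ => ?_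
    rw [associator_inv_tmulOver (heckeBasis_mem β ψ 1 1 g) (heckeBasis_mem β ψ 1 s (g' * t))
      (heckeBasis_mem β ψ s⁻¹ 1 t⁻¹), map_smul, whiskerRight_tmulOver, heckeMul_gen_left,
      if_pos rfl, smul_tmulOver, ← mul_assoc g g' t]
    congr 1
    simp only [smul_smul, ← Units.val_mul]
    congr 2
    have e := congrArg Additive.ofMul (ω.cocycle g (g' * t) s ((s : G)⁻¹ * (t : G)⁻¹))
    have e' := congrArg Additive.ofMul (ψ.coboundary g (g' * t) t⁻¹)
    apply Additive.ofMul.injective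
    simp only [heckeCoCoeff, Subgroup.coe_mul, Subgroup.coe_inv, Subgroup.coe_one, mul_assoc,
      mul_inv_cancel_left, mul_inv_cancel, mul_one, one_mul, ω.one_left, ω.one_right, inv_one,
      ofMul_mul, ofMul_inv] at e e' ⊢
    linear_combination (norm := abel) -e - e'
  · rw [map_zero]
    refine (congrArg _ (Finset.sum_eq_zero fun t _ => Finset.sum_eq_zero fun s _ => ?_)).trans
      (smul_zero _)
    rw [associator_inv_tmulOver (heckeBasis_mem β ψ 1 1 g) (heckeBasis_mem β ψ f s (g' * t))
      (heckeBasis_mem β ψ s⁻¹ 1 t⁻¹), map_smul, whiskerRight_tmulOver, heckeMul_gen_left,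
      if_neg h, zero_tmulOver, smul_zero, smul_zero]

lemma heckeFrobenius_right :
    heckeComul β ψ ▷ twistedHecke β ψ ≫ (α_ _ _ _).hom ≫ twistedHecke β ψ ◁ heckeMul β ψ =
      heckeMul β ψ ≫ heckeComul β ψ := by
  refine ((biGenerates_heckeBasis β ψ).tensor (biGenerates_heckeBasis β ψ)
    (fun g => heckeBasis_mem β ψ 1 1 g) (fun g => heckeBasis_mem β ψ 1 1 g)).hom_ext ?_
  rintro ⟨g, f, g'⟩
  simp only [lact_heckeBasis_one, bimod_comp_apply]
  rw [whiskerRight_tmulOver, heckeComul_gen, heckeCoprod, heckeMul_gen_right, smul_tmulOver,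
    map_smul, map_smul]
  simp only [sum_tmulOver, map_sum, smul_tmulOver, map_smul]
  split_ifs with h
  · subst h
    rw [map_smul, heckeComul_gen, heckeCoprod, smul_comm]
    -- Multiplication by `b(1,g',1)` on the second leg turns `t⁻¹` into `t⁻¹ g' = (g'⁻¹ t)⁻¹`, so
    -- the coproduct of `b(1,gg',1)` is summed over `g'⁻¹ t` instead of `t`.
    rw [← Equiv.sum_comp (Equiv.mulLeft g'⁻¹) (fun t => ∑ s : K,
      (heckeCoCoeff β ψ (g * g') t s : k) • tmulOver (heckeBasis β ψ 1 (g * g' * t) s) (heckeBasis β ψ s⁻¹ t⁻¹ 1))]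
    simp only [Finset.smul_sum]
    refine Finset.sum_congr rfl fun t _ => Finset.sum_congr rfl fun s _ => ?_
    rw [associator_tmulOver (heckeBasis_mem β ψ 1 s (g * t)) (heckeBasis_mem β ψ s⁻¹ 1 t⁻¹)
      (heckeBasis_mem β ψ 1 1 g'), map_smul, whiskerLeft_tmulOver, heckeMul_gen_right,
      if_pos rfl, tmulOver_smul, Equiv.coe_mulLeft, mul_assoc g g', mul_inv_cancel_left,
      mul_inv_rev, inv_inv]
    congr 1
    simp only [smul_smul, ← Units.val_mul]
    congr 2
    have e₁ := congrArg Additive.ofMul (ω.cocycle s (s : G)⁻¹ (t : G)⁻¹ g')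
    have e₂ := congrArg Additive.ofMul (ω.cocycle (g * t) s ((s : G)⁻¹ * (t : G)⁻¹) g')
    have e' := congrArg Additive.ofMul (ψ.coboundary (g * t) t⁻¹ g')
    apply Additive.ofMul.injective
    simp only [heckeCoCoeff, Subgroup.coe_mul, Subgroup.coe_inv, Subgroup.coe_one, mul_assoc,
      mul_inv_cancel_left, mul_inv_cancel, mul_one, one_mul, ω.one_left, mul_inv_rev, inv_inv,
      inv_one, ofMul_mul, ofMul_inv] at e₁ e₂ e' ⊢
    linear_combination (norm := abel) e₁ - e₂ + e'
  · rw [map_zero]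
    refine (congrArg _ (Finset.sum_eq_zero fun t _ => Finset.sum_eq_zero fun s _ => ?_)).trans
      (smul_zero _)
    rw [associator_tmulOver (heckeBasis_mem β ψ 1 s (g * t)) (heckeBasis_mem β ψ s⁻¹ 1 t⁻¹)
      (heckeBasis_mem β ψ f 1 g'), map_smul, whiskerLeft_tmulOver, heckeMul_gen_right,
      if_neg h, tmulOver_zero, smul_zero, smul_zero]

/-- The coalgebra structure of the twisted Hecke algebra. -/
noncomputable abbrev heckeComonObj [CharZero k] : ComonObj (twistedHecke β ψ) where
  counit := heckeCounit β ψ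
  comul := heckeComul β ψ
  counit_comul := by
    rw [← cancel_mono (λ_ _).hom, Iso.inv_hom_id]
    refine (biGenerates_heckeBasis β ψ).hom_ext fun g => ?_
    rw [bimod_comp_apply, bimod_comp_apply, heckeComul_gen, heckeCoprod, bimod_id_apply]
    simp only [map_smul, map_sum, whiskerRight_tmulOver, heckeCounit_apply]
    -- The counit kills the first leg `b(1,gt,s)` unless `t = g⁻¹`. Each `s ∈ K` then contributes
    -- `|L| b(1,g,1)`, and the prefactor cancels `|K||L|`.
    rw [Finset.sum_eq_single g⁻¹]
    · simp only [mul_inv_cancel, if_true, smul_tmulOver, map_smul, leftUnitor_tmulOver, one_mul,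
        lact_heckeBasis, β.one_left, Units.val_one, mul_one, inv_inv, smul_smul]
      refine (congrArg _ ((Finset.sum_congr rfl fun s _ => ?_).trans
        (sum_const_subgroup (k := k) K ((Nat.card L : k) • heckeBasis β ψ 1 g 1)))).trans ?_
      · rw [units_mul_mul_cancel]
        simp only [heckeCoCoeff, mul_inv_cancel, ψ.one_left, Subgroup.coe_inv,
          Subgroup.coe_one, inv_inv, ω.one_left, ω.one_right, inv_one, one_mul, mul_one]
        rw [← mul_inv, inv_mul_cancel]
      · exact natCard_inv_mul_inv_smul K L _
    · intro t _ ht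
      refine Finset.sum_eq_zero fun s _ => ?_
      rw [if_neg (fun h => ht (inv_eq_of_mul_eq_one_right h).symm), zero_tmulOver, map_zero,
        smul_zero]
    · simp
  comul_counit := by
    rw [← cancel_mono (ρ_ _).hom, Iso.inv_hom_id]
    refine (biGenerates_heckeBasis β ψ).hom_ext fun g => ?_
    rw [bimod_comp_apply, bimod_comp_apply, heckeComul_gen, heckeCoprod, bimod_id_apply]
    simp only [map_smul, map_sum, whiskerLeft_tmulOver, heckeCounit_apply]
    -- Here the counit is applied to the second leg, whose middle index is `t⁻¹`, so only `t = 1`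
    -- survives.
    rw [Finset.sum_eq_single 1]
    · simp only [inv_one, if_true, tmulOver_smul, map_smul, rightUnitor_tmulOver, mul_one,
        ract_heckeBasis, β.one_right, Units.val_one, smul_smul]
      refine (congrArg _ ((Finset.sum_congr rfl fun s _ => ?_).trans
        (sum_const_subgroup (k := k) K ((Nat.card L : k) • heckeBasis β ψ 1 g 1)))).trans ?_
      · rw [units_mul_mul_cancel, mul_inv_cancel]
        simp only [heckeCoCoeff, ψ.one_right, ω.one_right, Subgroup.coe_inv, Subgroup.coe_one,
          inv_one, one_mul, mul_one]
        rw [mul_mul_mul_comm, mul_inv_cancel, inv_mul_cancel, one_mul]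
      · exact natCard_inv_mul_inv_smul K L _
    · intro t _ ht
      refine Finset.sum_eq_zero fun s _ => ?_
      rw [if_neg (fun h => ht (inv_eq_one.1 h)), tmulOver_zero, map_zero, smul_zero]
    · simp
  comul_assoc :=
    letI := heckeMonObj β ψ
    coassoc_of_frobenius _ (heckeComul β ψ) (heckeFrobenius_left β ψ) (heckeFrobenius_right β ψ)

/-- Every summand of the coproduct multiplies back to `b(1,g,1)`: its coefficient is inverse to the
structure constant of `b(1,gt,s) b(s⁻¹,t⁻¹,1)`. The prefactor averages `|K||L|` equal terms. -/
lemma heckeComul_heckeMul [CharZero k] : heckeComul β ψ ≫ heckeMul β ψ = 𝟙 (twistedHecke β ψ) := by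
  refine (biGenerates_heckeBasis β ψ).hom_ext fun g => ?_
  rw [bimod_comp_apply, heckeComul_gen, heckeCoprod, bimod_id_apply]
  simp only [map_smul, map_sum, heckeMul_apply, mul_inv_cancel, if_true, mul_inv_cancel_right,
    smul_smul]
  refine (congrArg _ ((Finset.sum_congr rfl fun t _ => (Finset.sum_congr rfl fun s _ => ?_).trans
    (sum_const_subgroup (k := k) K (heckeBasis β ψ 1 g 1))).trans
    (sum_const_subgroup (k := k) L _))).trans ?_
  · have e : heckeCoCoeff β ψ g t s * heckeCoeff β ψ 1 (g * t) s s⁻¹ t⁻¹ 1 = 1 := by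
      apply Additive.ofMul.injective
      simp only [heckeCoCoeff, heckeCoeff, heckeCocycle, Subgroup.coe_mul, Subgroup.coe_inv,
        Subgroup.coe_one, one_mul, ω.one_left, ω.one_right, inv_one, mul_one, ofMul_mul, ofMul_inv,
        ofMul_one]
      abel
    rw [← Units.val_mul, e, Units.val_one, one_smul]
  · rw [smul_comm (Nat.card L : k), natCard_inv_mul_inv_smul]

/-- At `δ_1` the values of `β` in the unit and the counit cancel, so each `s ∈ K` contributes `|L|
δ_1`. -/
lemma heckeUnit_heckeCounit :
    heckeUnit β ψ ≫ heckeCounit β ψ =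
      ((Nat.card K : k) * (Nat.card L : k)) • 𝟙 (𝟙_ (GTFusionCat β)) := by
  refine (biGenerates_unitBasis β).hom_ext fun _ => ?_
  rw [bimod_comp_apply, heckeUnit_apply]
  simp only [map_sum, map_smul, heckeCounit_apply, if_true, inv_mul_cancel_right, smul_smul]
  refine (Finset.sum_congr rfl fun s _ => ?_).trans
    ((sum_const_subgroup (k := k) K ((Nat.card L : k) • unitBasis β 1)).trans (smul_smul _ _ _))
  rw [units_mul_mul_cancel _ (inv_mul_cancel _)]

end HeckeFrobenius

/-! ### Indecomposability -/

section HeckeIndecomposable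

open scoped Classical

open GVec

variable {k G : Type u} [Field k] [Group G] [Fintype G] {ω : ThreeCocycle k G} {K L : Subgroup G}
  {β : TwoCochain ω K}

lemma tensorHom_tmulOver {M M' N N' : GTFusionCat β} (f : M ⟶ M') (g : N ⟶ N')
    (v : M.X.carrier) (w : N.X.carrier) :
    (f ⊗ₘ g).hom.hom (tmulOver v w) = tmulOver (f.hom.hom v) (g.hom.hom w) := by
  rw [MonoidalCategory.tensorHom_def, bimod_comp_apply, whiskerRight_tmulOver,
    whiskerLeft_tmulOver]

lemma isMonHom_tmulOver {A B : GTFusionCat β} [MonObj A] [MonObj B] (f : A ⟶ B) [IsMonHom f]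
    (v w : A.X.carrier) :
    f.hom.hom (μ[A].hom.hom (tmulOver v w)) =
      μ[B].hom.hom (tmulOver (f.hom.hom v) (f.hom.hom w)) := by
  rw [← bimod_comp_apply, IsMonHom.mul_hom, bimod_comp_apply, tensorHom_tmulOver]

/-- The projection onto a direct summand of an algebra commutes with multiplication by elements. -/
lemma directSum_proj_mul {A S T : GTFusionCat β} [MonObj A] [MonObj S] [MonObj T] {p : A ⟶ S}
    {q : A ⟶ T} {i : S ⟶ A} {j : T ⟶ A} [IsMonHom p] [IsMonHom q] (hp : i ≫ p = 𝟙 S)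
    (hiq : i ≫ q = 0) (h : p ≫ i + q ≫ j = 𝟙 A) (v w : A.X.carrier) :
    μ[A].hom.hom (tmulOver ((p ≫ i).hom.hom v) w) =
        (p ≫ i).hom.hom (μ[A].hom.hom (tmulOver v w)) ∧
      μ[A].hom.hom (tmulOver v ((p ≫ i).hom.hom w)) =
        (p ≫ i).hom.hom (μ[A].hom.hom (tmulOver v w)) := by
  have hp' : ∀ v, p.hom.hom (i.hom.hom v) = v := fun v =>
    congrArg (fun f => GVec.Hom.hom (Bimod.Hom.hom f) v) hp
  have hq' : ∀ v, q.hom.hom (i.hom.hom v) = 0 := fun v =>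
    congrArg (fun f => GVec.Hom.hom (Bimod.Hom.hom f) v) hiq
  have h' : ∀ v, i.hom.hom (p.hom.hom v) + j.hom.hom (q.hom.hom v) = v := fun v =>
    congrArg (fun f => GVec.Hom.hom (Bimod.Hom.hom f) v) h
  constructor
  -- The product is split into its components in `S` and `T`. The component in `T` vanishes because
  -- `q` is multiplicative and kills the image of `i`; the component in `S` is computed from
  -- multiplicativity of `p` and `p (i v) = v`.
  · rw [← h' (μ[A].hom.hom (tmulOver ((p ≫ i).hom.hom v) w)), isMonHom_tmulOver p,
      isMonHom_tmulOver q, bimod_comp_apply, hp', hq', zero_tmulOver, map_zero, map_zero, add_zero,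
      bimod_comp_apply, isMonHom_tmulOver p]
  · rw [← h' (μ[A].hom.hom (tmulOver v ((p ≫ i).hom.hom w))), isMonHom_tmulOver p,
      isMonHom_tmulOver q, bimod_comp_apply, hp', hq', tmulOver_zero, map_zero, map_zero, add_zero,
      bimod_comp_apply, isMonHom_tmulOver p]

variable (β) (ψ : TwoCochain ω L)

lemma heckeBasis_ne_zero (f h : K) (g : L) : heckeBasis β ψ f g h ≠ 0 := by
  rw [← heckeBas_apply β ψ ((f, g), h)]
  exact (heckeBas β ψ).ne_zero _

/-- In degree `1`, the elements fixed under multiplication by `b(1, 1, 1)` on both sides are the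
multiples of `b(1, 1, 1)`. -/
lemma mem_span_heckeBasis_one {z : (twistedHecke β ψ).X.carrier}
    (hz : z ∈ (twistedHecke β ψ).X.component 1)
    (hl : (heckeMul β ψ).hom.hom (tmulOver (heckeBasis β ψ 1 1 1) z) = z)
    (hr : (heckeMul β ψ).hom.hom (tmulOver z (heckeBasis β ψ 1 1 1)) = z) :
    ∃ c : k, c • heckeBasis β ψ 1 1 1 = z := by
  -- With `e = b(1,1,1)`, `T` sends `v` to the part of degree `1` of `(e v) e`. It maps every basis
  -- vector into the line through `e`, and it fixes `z`.
  let T : Module.End k (twistedHecke β ψ).X.carrier :=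
    (twistedHecke β ψ).X.proj 1 ∘ₗ
      ((heckeMul β ψ).hom.hom ∘ₗ (tmulOverₗ _ _).flip (heckeBasis β ψ 1 1 1)) ∘ₗ
      ((heckeMul β ψ).hom.hom ∘ₗ tmulOverₗ _ _ (heckeBasis β ψ 1 1 1))
  have hT : ∀ v, T v = (twistedHecke β ψ).X.proj 1 ((heckeMul β ψ).hom.hom (tmulOver
      ((heckeMul β ψ).hom.hom (tmulOver (heckeBasis β ψ 1 1 1) v)) (heckeBasis β ψ 1 1 1))) :=
    fun _ => rfl
  have hspan : ⊤ ≤ (Submodule.span k {heckeBasis β ψ 1 1 1}).comap T := by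
    rw [← (heckeBas β ψ).span_eq, Submodule.span_le]
    rintro _ ⟨⟨⟨f, g⟩, h⟩, rfl⟩
    rw [heckeBas_apply, SetLike.mem_coe, Submodule.mem_comap, hT, heckeMul_gen_left]
    split_ifs
    · rw [smul_tmulOver, map_smul, map_smul, heckeMul_apply]
      refine Submodule.smul_mem _ _ ?_
      split_ifs
      · rw [map_smul, proj_of_mem _ (heckeBasis_mem β ψ _ _ _)]
        refine Submodule.smul_mem _ _ ?_
        split_ifs with hg
        · have hg' : 1 * g * 1 = 1 := by
            refine Subtype.ext ?_
            simpa using hg.symm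
          rw [hg']
          exact Submodule.mem_span_singleton_self _
        · exact zero_mem _
      · rw [map_zero]
        exact zero_mem _
    · rw [zero_tmulOver, map_zero, map_zero]
      exact zero_mem _
  have hTz : T z = z := by
    rw [hT, hl, hr, (mem_component_iff _).1 hz]
  rw [← Submodule.mem_span_singleton, ← hTz]
  exact hspan trivial

lemma heckeMul_one_gen (g : L) :
    (heckeMul β ψ).hom.hom (tmulOver (heckeBasis β ψ 1 1 1) (heckeBasis β ψ 1 g 1)) =
      heckeBasis β ψ 1 g 1 := by
  rw [heckeMul_gen_left, if_pos rfl, one_mul]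
  simp [ω.one_right, ψ.one_left]

/-- An endomorphism of the twisted Hecke algebra that commutes with multiplication by elements on
both sides is a multiple of the identity. -/
lemma hecke_endomorphism_eq_smul (P : twistedHecke β ψ ⟶ twistedHecke β ψ)
    (hl : ∀ v w, (heckeMul β ψ).hom.hom (tmulOver (P.hom.hom v) w) =
      P.hom.hom ((heckeMul β ψ).hom.hom (tmulOver v w)))
    (hr : ∀ v w, (heckeMul β ψ).hom.hom (tmulOver v (P.hom.hom w)) =
      P.hom.hom ((heckeMul β ψ).hom.hom (tmulOver v w))) :
    ∃ c : k, P = c • 𝟙 (twistedHecke β ψ) := by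
  have hz : P.hom.hom (heckeBasis β ψ 1 1 1) ∈ (twistedHecke β ψ).X.component 1 := by
    have h := hom_mem_component P.hom (heckeBasis_mem β ψ 1 1 1)
    simpa using h
  -- Since `e e = e` and `P` commutes with multiplication, `e P(e) = P(e) = P(e) e`, so `P(e) = c
  -- e`. Then `P(b(1,g,1)) = P(e) b(1,g,1) = c b(1,g,1)`.
  obtain ⟨c, hc⟩ := mem_span_heckeBasis_one β ψ hz (by rw [hr, heckeMul_one_gen])
    (by rw [hl, heckeMul_one_gen])
  refine ⟨c, (biGenerates_heckeBasis β ψ).hom_ext fun g => ?_⟩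
  rw [← heckeMul_one_gen, ← hl, ← hc, smul_tmulOver, map_smul, heckeMul_one_gen]
  rfl

lemma hecke_isIndecomposableAlg :
    letI := heckeMonObj β ψ
    IsIndecomposableAlg (twistedHecke β ψ) := by
  let _ := heckeMonObj β ψ
  refine ⟨fun h => heckeBasis_ne_zero β ψ 1 1 1 ?_, ?_⟩
  · exact congrArg (fun f => GVec.Hom.hom (Bimod.Hom.hom f) (heckeBasis β ψ 1 1 1))
      ((IsZero.iff_id_eq_zero _).1 h)
  · rintro S T _ _ ⟨p, q, i, j, _, _, hp, hq, hiq, hjp, h⟩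
    -- The idempotent `p ≫ i` is a scalar with `c * c = c`. If `c = 0`, the identity of `S` factors
    -- through `p ≫ i = 0`; if `c = 1`, then `p ≫ i` may be inserted into `j ≫ q = 𝟙 T`, which
    -- vanishes because `i ≫ q = 0`.
    obtain ⟨c, hc⟩ := hecke_endomorphism_eq_smul β ψ (p ≫ i)
      (fun v w => (directSum_proj_mul hp hiq h v w).1)
      (fun v w => (directSum_proj_mul hp hiq h v w).2)
    have hpi : (p ≫ i) ≫ (p ≫ i) = p ≫ i := by
      rw [Category.assoc, reassoc_of% hp]
    have hcc : c * c = c := by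
      rw [hc] at hpi
      have := congrArg (fun f => GVec.Hom.hom (Bimod.Hom.hom f) (heckeBasis β ψ 1 1 1)) hpi
      rw [Linear.smul_comp, Linear.comp_smul, Category.comp_id, smul_smul] at this
      exact smul_left_injective k (heckeBasis_ne_zero β ψ 1 1 1) this
    rcases eq_or_ne c 0 with h0 | h0
    · left
      rw [h0, zero_smul] at hc
      rw [IsZero.iff_id_eq_zero, ← hp, ← Category.id_comp (i ≫ p), ← hp, Category.assoc,
        reassoc_of% hc, zero_comp, comp_zero]
    · right
      rw [mul_left_cancel₀ h0 (hcc.trans (mul_one c).symm), one_smul] at hc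
      rw [IsZero.iff_id_eq_zero, ← hq, ← Category.id_comp q, ← hc, Category.assoc, hiq, comp_zero,
        comp_zero]

end HeckeIndecomposable

theorem proposition5p8 {k G : Type u} [Field k] [IsAlgClosed k] [CharZero k] [Group G] [Fintype G]
    (ω : ThreeCocycle k G) (K L : Subgroup G) (β : TwoCochain ω K) (ψ : TwoCochain ω L) :
    ∃ (_ : MonObj (twistedHecke β ψ)) (_ : ComonObj (twistedHecke β ψ)),
      IsHeckeStructure β ψ ∧
      IsFrobeniusAlg (twistedHecke β ψ) ∧
      IsIndecomposableAlg (twistedHecke β ψ) ∧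
      IsSeparableAlg (twistedHecke β ψ) ∧
      IsSpecialAlg k (twistedHecke β ψ) ∧
      Δ[twistedHecke β ψ] ≫ μ[twistedHecke β ψ] = 𝟙 (twistedHecke β ψ) ∧
      η[twistedHecke β ψ] ≫ ε[twistedHecke β ψ] =
        ((Nat.card K : k) * (Nat.card L : k)) • 𝟙 (𝟙_ (GTFusionCat β)) := by
  let _ := heckeMonObj β ψ
  let _ := heckeComonObj β ψ
  exact ⟨heckeMonObj β ψ, heckeComonObj β ψ,
    { mul := fun f f' h h' g g' => heckeMul_apply β ψ f h f' h' g g'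
      unit := heckeUnit_apply β ψ
      comul := heckeComul_apply β ψ
      counit := heckeCounit_apply β ψ },
    ⟨heckeFrobenius_left β ψ, heckeFrobenius_right β ψ⟩,
    hecke_isIndecomposableAlg β ψ,
    -- The comultiplication itself is the separating section: the Frobenius relations say that it is
    -- a morphism of `A`-bimodules.
    ⟨heckeComul β ψ, heckeComul_heckeMul β ψ, heckeFrobenius_right β ψ, heckeFrobenius_left β ψ⟩,
    ⟨heckeComul_heckeMul β ψ, _, mul_ne_zero (natCard_ne_zero K) (natCard_ne_zero L),
      heckeUnit_heckeCounit β ψ⟩,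
    heckeComul_heckeMul β ψ, heckeUnit_heckeCounit β ψ⟩
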